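/- Let $M$ be a smooth $n$-dimensional manifold and let $F:TM\to[0,\infty)$ be a Finsler structure: $F$ is smooth on the slit tangent bundle $N=TM\setminus\{0\}$, $F(x,\lambda y)=\lambda F(x,y)$ for $\lambda>0$, and the matrix $g_{ij}(x,y)=\tfrac12\,\partial^2F^2/\partial y^i\partial y^j$ is positive definite on $N$. Let $\pi:N\to M$ be the projection. In natural coordinates put $A_{ijk}=\tfrac F2\,\partial g_{ij}/\partial y^k$, $\gamma^i_{jk}=\tfrac12 g^{is}(\partial_{x^k}g_{sj}-\partial_{x^s}g_{jk}+\partial_{x^j}g_{sk})$, $N^i_j=\gamma^i_{jk}y^k-\tfrac1F A^i_{jk}\gamma^k_{rs}y^ry^s$ and $\frac{\delta}{\delta x^j}=\frac{\partial}{\partial x^j}-N^i_j\frac{\partial}{\partial y^i}$. The Chern connection $\nabla^{ch}$ on the bundle $\pi^*TM\to N$ has connection forms $\Gamma^i_{jk}\,dx^k$ with $\Gamma^i_{jk}=\tfrac12 g^{is}\big(\frac{\delta g_{sj}}{\delta x^k}-\frac{\delta g_{jk}}{\delta x^s}+\frac{\delta g_{sk}}{\delta x^j}\big)$, and the linear Berwald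 connection $\nabla^b$ has connection forms $\frac{\partial N^i_j}{\partial y^k}\,dx^k$. For $X\in T_xM$ and $u\in T_xM\setminus\{0\}$ let $\iota_u(X)=X^j\frac{\delta}{\delta x^j}|_u$ be the horizontal lift. Let $I_x=\{y\in T_xM: F(x,y)=1\}$ be the indicatrix, with the volume $dvol$ induced from the Riemannian manifold $(T_xM\setminus\{0\},g_x)$. The averaged Berwald connection $\langle\nabla^b\rangle$ is $$\langle\nabla^b\rangle_XY=\frac1{\mathrm{vol}(I_x)}\int_{I_x}\nabla^b_{\iota_u(X)}\pi^*Y\,dvol(u),\qquad X\in T_xM,$$ where $\pi^*_uTM$ is identified with $T_xM$. Assume that $F$ is a Berwald structure, that is, that the coefficients $\Gamma^i_{jk}$ of the Chern connection in natural coordinates do not depend on $y$, and let $h$ be a smooth Riemannian metric on $M$ with $\nabla^b\pi^*h=0$. Let $\nabla^h$ be the Levi-Civita connection of $h$, that is, the torsion-free affine connection on $M$ compatible with $h$ (it exists). Then: 1. $\nabla^h_XY=\langle\nabla^b\rangle_XY=\nabla^b_{\iota_u(X)}\pi^*Y=\nabla^{ch}_{\iota_u(X)}\pi^*Y$ for all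 $x\in M$, $X\in T_xM$, $u\in T_xM\setminus\{0\}$ and all vector fields $Y$ on $M$ that are differentiable at $x$. 2. For every $C^1$ curve $c:[0,1]\to M$, a nowhere vanishing vector field $U$ along $c$ is $\nabla^h$-parallel if and only if $t\mapsto(c(t),U(t))$ is a horizontal curve in $N$, that is, $\dot U^i+N^i_j(c,U)\,\dot c^j=0$. The $\nabla^h$-parallel transport $\tau_c:T_{c(0)}M\to T_{c(1)}M$ exists, is unique, and maps the indicatrix onto the indicatrix: $\tau_c(I_{c(0)})=I_{c(1)}$. -/

import Mathlib

open Set MeasureTheory Bundle Manifold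
open scoped ContDiff

noncomputable section

/-- The model space `ℝⁿ`. -/
abbrev Rn (n : ℕ) : Type := EuclideanSpace ℝ (Fin n)

/-! ### Finsler tensors in natural coordinates

Throughout this section `φ : ℝⁿ → ℝⁿ → ℝ` is a Finsler function written in natural coordinates
`(x, y) = (x¹, …, xⁿ, y¹, …, yⁿ)`. -/

namespace NatCoord

variable {n : ℕ}

/-- `∂f / ∂xᵏ` at `(x, y)`. -/
def dx (k : Fin n) (f : Rn n → Rn n → ℝ) (x y : Rn n) : ℝ :=
  fderiv ℝ (fun x' ↦ f x' y) x (EuclideanSpace.single k 1)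

/-- `∂f / ∂yᵏ` at `(x, y)`. -/
def dy (k : Fin n) (f : Rn n → Rn n → ℝ) (x y : Rn n) : ℝ :=
  fderiv ℝ (fun y' ↦ f x y') y (EuclideanSpace.single k 1)

/-- The matrix `g_{ij} = ½ ∂²(φ²)/∂yⁱ∂yʲ` of the fundamental tensor. -/
def fund (φ : Rn n → Rn n → ℝ) (x y : Rn n) : Matrix (Fin n) (Fin n) ℝ :=
  Matrix.of fun i j ↦ (1 / 2) * dy i (dy j (fun x' y' ↦ φ x' y' ^ 2)) x y

/-- The components `A_{ijk} = (φ / 2) ∂g_{ij}/∂yᵏ` of the Cartan tensor. -/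
def cartan (φ : Rn n → Rn n → ℝ) (x y : Rn n) (i j k : Fin n) : ℝ :=
  φ x y / 2 * dy k (fun x' y' ↦ fund φ x' y' i j) x y

/-- The components `Aⁱ_{jk} = g^{il} A_{ljk}`. -/
def cartanUp (φ : Rn n → Rn n → ℝ) (x y : Rn n) (i j k : Fin n) : ℝ :=
  ∑ l, (fund φ x y)⁻¹ i l * cartan φ x y l j k

/-- The formal Christoffel symbols
`γⁱ_{jk} = ½ g^{is} (∂g_{sj}/∂xᵏ - ∂g_{jk}/∂xˢ + ∂g_{sk}/∂xʲ)`. -/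
def formalChristoffel (φ : Rn n → Rn n → ℝ) (x y : Rn n) (i j k : Fin n) : ℝ :=
  (1 / 2) * ∑ s, (fund φ x y)⁻¹ i s *
    (dx k (fun x' y' ↦ fund φ x' y' s j) x y - dx s (fun x' y' ↦ fund φ x' y' j k) x y
      + dx j (fun x' y' ↦ fund φ x' y' s k) x y)

/-- The coefficients `Nⁱ_j` of the non-linear connection, given by
`Nⁱ_j / φ = γⁱ_{jk} yᵏ/φ - Aⁱ_{jk} γᵏ_{rs} (yʳ/φ) (yˢ/φ)`. -/
def nonlinear (φ : Rn n → Rn n → ℝ) (x y : Rn n) (i j : Fin n) : ℝ :=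
  φ x y * (∑ k, formalChristoffel φ x y i j k * (y k / φ x y)
    - ∑ k, ∑ r, ∑ s, cartanUp φ x y i j k * formalChristoffel φ x y k r s
        * (y r / φ x y) * (y s / φ x y))

/-- The horizontal derivative `δf/δxʲ = ∂f/∂xʲ - Nⁱ_j ∂f/∂yⁱ`. -/
def horiz (φ : Rn n → Rn n → ℝ) (j : Fin n) (f : Rn n → Rn n → ℝ) (x y : Rn n) : ℝ :=
  dx j f x y - ∑ i, nonlinear φ x y i j * dy i f x y

/-- The coefficients of the Chern connection,
`Γⁱ_{jk} = ½ g^{is} (δg_{sj}/δxᵏ - δg_{jk}/δxˢ + δg_{sk}/δxʲ)`: the only coefficients for which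
`ωⁱ_j = Γⁱ_{jk} dxᵏ` satisfies `dxʲ ∧ ωⁱ_j = 0` and
`dg_{ij} - g_{kj} ωᵏ_i - g_{ik} ωᵏ_j = 2 A_{ijk} δyᵏ/φ`. -/
def chern (φ : Rn n → Rn n → ℝ) (x y : Rn n) (i j k : Fin n) : ℝ :=
  (1 / 2) * ∑ s, (fund φ x y)⁻¹ i s *
    (horiz φ k (fun x' y' ↦ fund φ x' y' s j) x y - horiz φ s (fun x' y' ↦ fund φ x' y' j k) x y
      + horiz φ j (fun x' y' ↦ fund φ x' y' s k) x y)

/-- The coefficients `∂Nⁱ_j/∂yᵏ` of the (linear) Berwald connection. -/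
def berwald (φ : Rn n → Rn n → ℝ) (x y : Rn n) (i j k : Fin n) : ℝ :=
  dy k (fun x' y' ↦ nonlinear φ x' y' i j) x y

/-- The vector `(Γⁱ_{jk} wʲ zᵏ)_i` for connection coefficients `Γ`. -/
def contract (Γ : Fin n → Fin n → Fin n → ℝ) (w z : Rn n) : Rn n :=
  WithLp.toLp 2 fun i ↦ ∑ j, ∑ k, Γ i j k * w j * z k

end NatCoord

/-! ### Finsler structures on a manifold -/

section Manifold

variable {n : ℕ} {M : Type*} [TopologicalSpace M] [ChartedSpace (Rn n) M]

/-- A function on the tangent bundle written in the natural coordinates induced by a chart `e`. -/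
def inChart (F : TangentBundle (𝓡 n) M → ℝ) (e : OpenPartialHomeomorph M (Rn n)) :
    Rn n → Rn n → ℝ :=
  fun x y ↦ F ⟨e.symm x, mfderiv (𝓡 n) (𝓡 n) e.symm x y⟩

/-- Finsler structures: smooth on the slit tangent bundle, positively homogeneous, strongly
convex. -/
structure IsFinsler [IsManifold (𝓡 n) ∞ M] (F : TangentBundle (𝓡 n) M → ℝ) : Prop where
  nonneg : ∀ p, 0 ≤ F p
  smooth : ContMDiffOn (𝓡 n).tangent 𝓘(ℝ, ℝ) ∞ F {p | p.2 ≠ 0}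
  homogeneous : ∀ (x : M) (y : TangentSpace (𝓡 n) x) (c : ℝ), 0 < c →
    F ⟨x, c • y⟩ = c * F ⟨x, y⟩
  convex : ∀ e ∈ IsManifold.maximalAtlas (𝓡 n) ∞ M, ∀ x ∈ e.target, ∀ y : Rn n, y ≠ 0 →
    (NatCoord.fund (inChart F e) x y).PosDef

/-- A Finsler structure is a Berwald structure if the coefficients of the Chern connection in
natural coordinates do not depend on `y`. -/
structure IsBerwald [IsManifold (𝓡 n) ∞ M] (F : TangentBundle (𝓡 n) M → ℝ) : Prop
    extends IsFinsler F where
  chern_eq : ∀ e ∈ IsManifold.maximalAtlas (𝓡 n) ∞ M, ∀ x ∈ e.target, ∀ y z : Rn n,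
    y ≠ 0 → z ≠ 0 → NatCoord.chern (inChart F e) x y = NatCoord.chern (inChart F e) x z

/-- The indicatrix `I_x = {y ∈ T_xM | F(x, y) = 1}`. -/
def indicatrix (F : TangentBundle (𝓡 n) M → ℝ) (x : M) : Set (TangentSpace (𝓡 n) x) :=
  {y | F ⟨x, y⟩ = 1}

/-! Below, quantities at a point `x` are computed in the natural coordinates of the preferred chart
`chartAt x`; for these `TangentSpace (𝓡 n) x` is `ℝⁿ` by definition, a tangent vector being the
tuple of its components. -/

/-- `F` in the natural coordinates of the preferred chart at `x`. -/
def localF (F : TangentBundle (𝓡 n) M → ℝ) (x : M) : Rn n → Rn n → ℝ :=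
  inChart F (chartAt (Rn n) x)

variable [IsManifold (𝓡 n) ∞ M]

/-- The components of a tangent vector `v` at a point near `x` in the natural coordinates of the
preferred chart at `x`. -/
def comps (x : M) (v : TangentBundle (𝓡 n) M) : Rn n :=
  (trivializationAt (Rn n) (TangentSpace (𝓡 n)) x v).2

/-- The vector field `Y` is differentiable at `x`. -/
def DifferentiableFieldAt (Y : Π p : M, TangentSpace (𝓡 n) p) (x : M) : Prop :=
  MDifferentiableAt (𝓡 n) ((𝓡 n).prod 𝓘(ℝ, Rn n))
    (fun p ↦ TotalSpace.mk' (Rn n) (E := fun p : M ↦ TangentSpace (𝓡 n) p) p (Y p)) x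

/-- The vector with components `X(Yⁱ) + Γⁱ_{jk} Yʲ Xᵏ` at `x`, for connection coefficients `Γ` at
`x`, a vector `X ∈ T_xM` and a vector field `Y` (differentiable at `x`). -/
def natDeriv (x : M) (Γ : Fin n → Fin n → Fin n → ℝ) (X : TangentSpace (𝓡 n) x)
    (Y : Π p : M, TangentSpace (𝓡 n) p) : Rn n :=
  mvfderiv (𝓡 n) (fun p ↦ comps x ⟨p, Y p⟩) x X + NatCoord.contract Γ (Y x) X

/-- `∇_{ι_u(X)} π^*Y` for the Chern connection on `π^*TM`, where `ι_u(X)` is the horizontal lift of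
`X ∈ T_xM` to the point `u ∈ T_xM ∖ {0}`, as an element of `π^*_u TM = T_xM`. -/
def chernDeriv (F : TangentBundle (𝓡 n) M → ℝ) (x : M) (u : Rn n) (X : TangentSpace (𝓡 n) x)
    (Y : Π p : M, TangentSpace (𝓡 n) p) : Rn n :=
  natDeriv x (NatCoord.chern (localF F x) (chartAt (Rn n) x x) u) X Y

/-- `∇_{ι_u(X)} π^*Y` for the Berwald connection on `π^*TM`. -/
def berwaldDeriv (F : TangentBundle (𝓡 n) M → ℝ) (x : M) (u : Rn n) (X : TangentSpace (𝓡 n) x)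
    (Y : Π p : M, TangentSpace (𝓡 n) p) : Rn n :=
  natDeriv x (NatCoord.berwald (localF F x) (chartAt (Rn n) x x) u) X Y

/-- The volume measure on the indicatrix `I_x` (as a measure on `T_xM = ℝⁿ` carried by `I_x`)
induced from the Riemannian volume `√(det g_{ij}(x, y)) dy` of `(T_xM ∖ {0}, g_x)`.
The unit normal of `I_x` at `y` for `g_{(x, y)}` is `y` itself and `g` is homogeneous of degree `0`,
so that the Riemannian volume is `rⁿ⁻¹ dr ∧ dvol` in the polar coordinates `y = r u`, `u ∈ I_x`.
Hence `vol(A) = n · Vol({r u | 0 < r < 1, u ∈ A})`. -/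
def indicatrixVolume (F : TangentBundle (𝓡 n) M → ℝ) (x : M) : Measure (Rn n) :=
  (n : ENNReal) •
    ((((volume : Measure (Rn n)).withDensity fun y ↦ ENNReal.ofReal
        (Real.sqrt (NatCoord.fund (localF F x) (chartAt (Rn n) x x) y).det)).restrict
      {y : Rn n | y ≠ 0 ∧ F ⟨x, y⟩ < 1}).map fun y : Rn n ↦ (F ⟨x, y⟩)⁻¹ • y)

/-- The averaged Berwald connection
`⟨∇⟩_X Y = vol(I_x)⁻¹ ∫_{I_x} ∇_{ι_u(X)} π^*Y dvol(u)`. -/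
def averagedBerwald (F : TangentBundle (𝓡 n) M → ℝ) (x : M) (X : TangentSpace (𝓡 n) x)
    (Y : Π p : M, TangentSpace (𝓡 n) p) : Rn n :=
  ⨍ u, berwaldDeriv F x u X Y ∂(indicatrixVolume F x)

/-- Smooth Riemannian metrics on `M`. -/
abbrev RMetric (n : ℕ) (M : Type*) [TopologicalSpace M] [ChartedSpace (Rn n) M]
    [IsManifold (𝓡 n) ∞ M] :=
  ContMDiffRiemannianMetric (𝓡 n) ∞ (Rn n) (fun x : M ↦ TangentSpace (𝓡 n) x)

/-- `∇ π^*h = 0` for the Berwald connection `∇`. Both `∇_V π^*Y = 0` and `V(h(Y, Z) ∘ π) = 0` for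
vertical `V`, so that only the derivatives along horizontal vectors `ι_u(X)` matter, and by
tensoriality sections of the form `π^*Y`, `π^*Z` suffice. -/
def BerwaldParallel (F : TangentBundle (𝓡 n) M → ℝ) (h : RMetric n M) : Prop :=
  ∀ (x : M) (u : TangentSpace (𝓡 n) x), u ≠ 0 →
    ∀ (X : TangentSpace (𝓡 n) x) (Y Z : Π p : M, TangentSpace (𝓡 n) p),
      DifferentiableFieldAt Y x → DifferentiableFieldAt Z x →
      mvfderiv (𝓡 n) (fun p ↦ h.inner p (Y p) (Z p)) x X
        = h.inner x (berwaldDeriv F x u X Y) (Z x) + h.inner x (Y x) (berwaldDeriv F x u X Z)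

/-- Affine connections on `M`. -/
abbrev AffineConnection (n : ℕ) (M : Type*) [TopologicalSpace M] [ChartedSpace (Rn n) M]
    [IsManifold (𝓡 n) ∞ M] :=
  CovariantDerivative (𝓡 n) (Rn n) (fun x : M ↦ TangentSpace (𝓡 n) x)

/-- `nabla` is the Levi-Civita connection of `h`: it is torsion-free and compatible with `h`. -/
def IsLeviCivita (h : RMetric n M) (nabla : AffineConnection n M) : Prop :=
  haveI : IsManifold (𝓡 n) 2 M := .of_le (n := ∞) (by norm_cast)
  letI : RiemannianBundle (fun x : M ↦ TangentSpace (𝓡 n) x) := ⟨h.toRiemannianMetric⟩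
  nabla.torsion = 0 ∧ nabla.IsMetricCompatible

/-! ### Parallel transport along a curve `c : [0, 1] → M`. -/

/-- The velocity of `c` at the time `t ∈ [0, 1]`. -/
def velocity (c : ℝ → M) (t : ℝ) : TangentSpace (𝓡 n) (c t) :=
  mfderivWithin 𝓘(ℝ, ℝ) (𝓡 n) c (Icc 0 1) t (1 : ℝ)

/-- `W` is a parallel vector field along `c : [0, 1] → M` for `nabla`. In the natural coordinates
of the preferred chart at `c t` the equation is `dWⁱ/dt = - Wʲ (∇_{ċ} ∂_j)ⁱ`; here
`FiberBundle.extend (Rn n) (W t)` is the local vector field `Wʲ(t) ∂_j` with constant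
components. -/
def IsParallelAlong (nabla : AffineConnection n M) (c : ℝ → M)
    (W : Π t : ℝ, TangentSpace (𝓡 n) (c t)) : Prop :=
  ∀ t ∈ Icc (0 : ℝ) 1, HasDerivWithinAt (fun s ↦ comps (c t) ⟨c s, W s⟩)
    (-(nabla (FiberBundle.extend (Rn n) (W t)) (c t) (velocity c t) : Rn n)) (Icc 0 1) t

/-- `τ` is the parallel transport `T_{c(0)}M → T_{c(1)}M` of `nabla` along `c`. -/
def IsParallelTransport (nabla : AffineConnection n M) (c : ℝ → M)
    (τ : TangentSpace (𝓡 n) (c 0) → TangentSpace (𝓡 n) (c 1)) : Prop :=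
  ∀ v, ∃ W : Π t : ℝ, TangentSpace (𝓡 n) (c t),
    IsParallelAlong nabla c W ∧ W 0 = v ∧ W 1 = τ v

/-- `U` is a horizontal lift of `c : [0, 1] → M` to the slit tangent bundle: it does not vanish, and
`t ↦ (c t, U t)` is tangent to the horizontal distribution `δyⁱ = dyⁱ + Nⁱ_j dxʲ = 0` of `F`. -/
def IsHorizontalLift (F : TangentBundle (𝓡 n) M → ℝ) (c : ℝ → M)
    (U : Π t : ℝ, TangentSpace (𝓡 n) (c t)) : Prop :=
  ∀ t ∈ Icc (0 : ℝ) 1, U t ≠ 0 ∧ HasDerivWithinAt (fun s ↦ comps (c t) ⟨c s, U s⟩)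
    (WithLp.toLp 2 fun i ↦ -∑ j, NatCoord.nonlinear (localF F (c t))
      (chartAt (Rn n) (c t) (c t)) (U t) i j * (show Rn n from velocity c t) j) (Icc 0 1) t

end Manifold

end

noncomputable section

namespace NatCoord

variable {n : ℕ}

/-! ### Calculus in natural coordinates -/

/-! In natural coordinates everything rests on two identities, both consequences of Euler's theorem
for homogeneous functions. First, `Γⁱ_{jk} yᵏ = Nⁱ_j` (`sum_chern`). If `Γ` does not depend on `y`,
then `N` is linear in `y`, so `∂Nⁱ_j/∂yᵏ = Γⁱ_{jk}`: the Berwald and Chern connections share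
coefficients `Γ(x)`, which are symmetric in the lower indices (`berwald_eq_chern`, `chern_symm`).
The integrand of the averaged connection is then constant off the origin. It remains to see that the
induced volume of the indicatrix is finite, nonzero and carried by nonzero vectors
(`average_indicatrixVolume`).

The coefficients `Γ(x)` define an affine connection on `M`. Symmetry makes it torsion-free, and `∇
π^*h = 0` says that it is compatible with `h`. This proves existence of the Levi-Civita connection,
and Koszul's formula shows that any Levi-Civita connection of `h` has the same coefficients
(`nabla_eq_natDeriv`).

By the first identity, the parallel equation `U̇ⁱ + Γⁱ_{jk} Uʲ ċᵏ = 0` is exactly the horizontality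
equation `U̇ⁱ + Nⁱ_j(c, U) ċʲ = 0`. The second identity is `δφ/δxʲ = 0` (`horiz_self`): `F` is
constant along horizontal curves, so parallel transport preserves indicatrices. Transport exists and
is unique by linear ODE theory. The required continuity of the coefficients within a fixed chart is
read off from Koszul's formula for the smooth metric `h` (`comps_nabla_frame`). Surjectivity onto
the indicatrix comes from solving the equation backwards from time `1`. -/

/-- `f` is smooth on `U × (ℝⁿ ∖ {0})`. -/
def SlitSmooth (U : Set (Rn n)) (f : Rn n → Rn n → ℝ) : Prop :=
  ContDiffOn ℝ ∞ (Function.uncurry f) (U ×ˢ {0}ᶜ)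

lemma isOpen_slit {U : Set (Rn n)} (hU : IsOpen U) : IsOpen (U ×ˢ ({0}ᶜ : Set (Rn n))) :=
  hU.prod isOpen_compl_singleton

section calculus

variable {U : Set (Rn n)} {f g : Rn n → Rn n → ℝ} {x y : Rn n}

lemma SlitSmooth.contDiffAt (hf : SlitSmooth U f) (hU : IsOpen U) (hx : x ∈ U) (hy : y ≠ 0) :
    ContDiffAt ℝ ∞ (Function.uncurry f) (x, y) :=
  ContDiffOn.contDiffAt hf ((isOpen_slit hU).mem_nhds ⟨hx, hy⟩)

lemma SlitSmooth.differentiableAt (hf : SlitSmooth U f) (hU : IsOpen U) (hx : x ∈ U)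
    (hy : y ≠ 0) : DifferentiableAt ℝ (Function.uncurry f) (x, y) :=
  (hf.contDiffAt hU hx hy).differentiableAt (by simp)

lemma SlitSmooth.contDiffAt_right (hf : SlitSmooth U f) (hU : IsOpen U) (hx : x ∈ U)
    (hy : y ≠ 0) : ContDiffAt ℝ ∞ (f x) y :=
  (hf.contDiffAt hU hx hy).comp (f := fun y' ↦ (x, y')) y (contDiffAt_const.prodMk contDiffAt_id)

lemma SlitSmooth.differentiableAt_right (hf : SlitSmooth U f) (hU : IsOpen U) (hx : x ∈ U)
    (hy : y ≠ 0) : DifferentiableAt ℝ (f x) y :=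
  (hf.contDiffAt_right hU hx hy).differentiableAt (by simp)

lemma SlitSmooth.differentiableAt_left (hf : SlitSmooth U f) (hU : IsOpen U) (hx : x ∈ U)
    (hy : y ≠ 0) : DifferentiableAt ℝ (fun x' ↦ f x' y) x :=
  ((hf.contDiffAt hU hx hy).comp (f := fun x' ↦ (x', y)) x
    (contDiffAt_id.prodMk contDiffAt_const)).differentiableAt (by simp)

/-- Rewriting a partial derivative through the joint derivative gives its joint smoothness in `(x,
y)`, and hence allows it to be differentiated again. -/
lemma SlitSmooth.dy_eq (hf : SlitSmooth U f) (hU : IsOpen U) (hx : x ∈ U) (hy : y ≠ 0)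
    (k : Fin n) :
    dy k f x y = fderiv ℝ (Function.uncurry f) (x, y) (0, EuclideanSpace.single k 1) := by
  have h := (hf.differentiableAt hU hx hy).hasFDerivAt.comp y (hasFDerivAt_prodMk_right x y)
  have h' : HasFDerivAt (fun y' ↦ f x y') _ y := h
  rw [dy, h'.fderiv]
  simp

lemma SlitSmooth.dx_eq (hf : SlitSmooth U f) (hU : IsOpen U) (hx : x ∈ U) (hy : y ≠ 0)
    (k : Fin n) :
    dx k f x y = fderiv ℝ (Function.uncurry f) (x, y) (EuclideanSpace.single k 1, 0) := by
  have h := (hf.differentiableAt hU hx hy).hasFDerivAt.comp (f := fun x' ↦ (x', y)) x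
    (hasFDerivAt_prodMk_left x y)
  have h' : HasFDerivAt (fun x' ↦ f x' y) _ x := h
  rw [dx, h'.fderiv]
  simp

lemma SlitSmooth.dy (hf : SlitSmooth U f) (hU : IsOpen U) (k : Fin n) :
    SlitSmooth U (dy k f) := by
  have h : ContDiffOn ℝ ∞ (fun p ↦ fderiv ℝ (Function.uncurry f) p
      ((0 : Rn n), EuclideanSpace.single k (1 : ℝ))) (U ×ˢ {0}ᶜ) :=
    (ContDiffOn.fderiv_of_isOpen hf (isOpen_slit hU) (by simp)).clm_apply contDiffOn_const
  exact h.congr fun p hp ↦ hf.dy_eq hU hp.1 hp.2 k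

lemma fderiv_apply_eq_sum (L : Rn n →L[ℝ] ℝ) (v : Rn n) :
    L v = ∑ k, v k * L (EuclideanSpace.single k 1) := by
  conv_lhs => rw [← (EuclideanSpace.basisFun (Fin n) ℝ).sum_repr v]
  simp

lemma SlitSmooth.fderiv_apply (hf : SlitSmooth U f) (hU : IsOpen U) (hx : x ∈ U) (hy : y ≠ 0)
    (v w : Rn n) : fderiv ℝ (Function.uncurry f) (x, y) (v, w)
      = ∑ k, v k * NatCoord.dx k f x y + ∑ k, w k * NatCoord.dy k f x y := by
  have h1 := fderiv_apply_eq_sum ((fderiv ℝ (Function.uncurry f) (x, y)).comp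
    (ContinuousLinearMap.inl ℝ (Rn n) (Rn n))) v
  have h2 := fderiv_apply_eq_sum ((fderiv ℝ (Function.uncurry f) (x, y)).comp
    (ContinuousLinearMap.inr ℝ (Rn n) (Rn n))) w
  simp only [ContinuousLinearMap.comp_apply, ContinuousLinearMap.inl_apply,
    ContinuousLinearMap.inr_apply] at h1 h2
  simp only [hf.dx_eq hU hx hy, hf.dy_eq hU hx hy, ← h1, ← h2, ← map_add]
  simp

lemma SlitSmooth.dy_comm (hf : SlitSmooth U f) (hU : IsOpen U) (hx : x ∈ U) (hy : y ≠ 0)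
    (i j : Fin n) :
    NatCoord.dy i (NatCoord.dy j f) x y = NatCoord.dy j (NatCoord.dy i f) x y := by
  have hs := (hf.contDiffAt_right hU hx hy).isSymmSndFDerivAt (by simp; norm_cast)
  have hd : DifferentiableAt ℝ (fderiv ℝ (f x)) y :=
    ((hf.contDiffAt_right hU hx hy).fderiv_right (m := 1) (by norm_cast)).differentiableAt
      (by simp)
  have key (i j : Fin n) : NatCoord.dy i (NatCoord.dy j f) x y
      = fderiv ℝ (fderiv ℝ (f x)) y (EuclideanSpace.single i 1) (EuclideanSpace.single j 1) := by
    have : HasFDerivAt (fun y' ↦ fderiv ℝ (f x) y' (EuclideanSpace.single j (1 : ℝ))) _ y :=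
      hd.hasFDerivAt.clm_apply (hasFDerivAt_const _ _)
    change fderiv ℝ (fun y' ↦ fderiv ℝ (f x) y' (EuclideanSpace.single j (1 : ℝ))) y _ = _
    rw [this.fderiv]
    simp
  rw [key, key]
  exact hs _ _

lemma eventually_ne_zero (hy : y ≠ 0) : ∀ᶠ z in nhds y, z ≠ 0 :=
  isOpen_compl_singleton.mem_nhds hy

/-- The slit is open, so identities known only off the zero section may be differentiated in `y`. -/
lemma dy_congr (hy : y ≠ 0) (h : ∀ z, z ≠ 0 → f x z = g x z) (k : Fin n) :
    NatCoord.dy k f x y = NatCoord.dy k g x y := by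
  have : (fun z ↦ f x z) =ᶠ[nhds y] fun z ↦ g x z := (eventually_ne_zero hy).mono h
  rw [NatCoord.dy, NatCoord.dy, this.fderiv_eq]

lemma dx_congr (hU : IsOpen U) (hx : x ∈ U) (h : ∀ z ∈ U, f z y = g z y) (k : Fin n) :
    NatCoord.dx k f x y = NatCoord.dx k g x y := by
  have : (fun z ↦ f z y) =ᶠ[nhds x] fun z ↦ g z y :=
    Filter.mem_of_superset (hU.mem_nhds hx) h
  rw [NatCoord.dx, NatCoord.dx, this.fderiv_eq]

/-- Euler's identity. -/
lemma euler (hf : SlitSmooth U f) (hU : IsOpen U) (hx : x ∈ U) (hy : y ≠ 0) (m : ℕ)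
    (hom : ∀ c : ℝ, 0 < c → f x (c • y) = c ^ m * f x y) :
    ∑ k, y k * NatCoord.dy k f x y = m * f x y := by
  have h0 : HasDerivAt (fun c : ℝ ↦ c • y) y 1 := by
    simpa using (hasDerivAt_id (1 : ℝ)).smul_const y
  have h1 : HasDerivAt (fun c : ℝ ↦ f x (c • y)) (fderiv ℝ (f x) y y) 1 := by
    have hd : HasFDerivAt (f x) (fderiv ℝ (f x) y) ((1 : ℝ) • y) := by
      simpa using (hf.differentiableAt_right hU hx hy).hasFDerivAt
    exact hd.comp_hasDerivAt (1 : ℝ) h0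
  have h2 : HasDerivAt (fun c : ℝ ↦ f x (c • y)) (m * f x y) 1 := by
    have h3 : HasDerivAt (fun c : ℝ ↦ c ^ m * f x y) (m * f x y) 1 := by
      simpa using (hasDerivAt_pow m (1 : ℝ)).mul_const (f x y)
    exact h3.congr_of_eventuallyEq ((lt_mem_nhds one_pos).mono hom)
  -- Both sides are the derivative of `c ↦ f x (c • y)` at `c = 1`.
  rw [← h1.unique h2, fderiv_apply_eq_sum]
  rfl

/-- Differentiating `f(c z) = c^(m+1) f(z)` in `z` produces a factor `c` on the left, which cancels
one power on the right. -/
lemma dy_homogeneous (m : ℕ)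
    (hom : ∀ z, z ≠ 0 → ∀ c : ℝ, 0 < c → f x (c • z) = c ^ (m + 1) * f x z) (k : Fin n)
    {z : Rn n} (hz : z ≠ 0) {c : ℝ} (hc : 0 < c) :
    NatCoord.dy k f x (c • z) = c ^ m * NatCoord.dy k f x z := by
  have h1 : (fun z ↦ f x (c • z)) =ᶠ[nhds z] fun z ↦ c ^ (m + 1) * f x z :=
    (eventually_ne_zero hz).mono fun z hz ↦ hom z hz c hc
  have h2 := h1.fderiv_eq (𝕜 := ℝ)
  rw [fderiv_comp_smul] at h2
  have h3 : fderiv ℝ (fun z ↦ c ^ (m + 1) * f x z) z = c ^ (m + 1) • fderiv ℝ (f x) z :=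
    congrFun (fderiv_const_smul_field (c ^ (m + 1)) (f := f x)) z
  rw [h3] at h2
  have h4 := DFunLike.congr_fun h2 (EuclideanSpace.single k (1 : ℝ))
  simp only [smul_apply, smul_eq_mul, pow_succ'] at h4
  change fderiv ℝ (f x) (c • z) _ = c ^ m * fderiv ℝ (f x) z _
  have := hc.ne'
  rw [mul_assoc] at h4
  exact mul_left_cancel₀ this h4

end calculus

/-! ### The fundamental tensor and the connection coefficients -/

/-- Finsler functions on `U × ℝⁿ` in natural coordinates. -/
structure IsLocalFinsler (U : Set (Rn n)) (φ : Rn n → Rn n → ℝ) : Prop where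
  isOpen : IsOpen U
  smooth : SlitSmooth U φ
  nonneg : ∀ x y, 0 ≤ φ x y
  hom : ∀ x ∈ U, ∀ y, ∀ c : ℝ, 0 < c → φ x (c • y) = c * φ x y
  posDef : ∀ x ∈ U, ∀ y, y ≠ 0 → (fund φ x y).PosDef

/-- The derivative `∂g_{ij}/∂yᵏ`. -/
def fundDeriv (φ : Rn n → Rn n → ℝ) (x y : Rn n) (k i j : Fin n) : ℝ :=
  dy k (fun x' y' ↦ fund φ x' y' i j) x y

lemma horiz_fund (φ : Rn n → Rn n → ℝ) (x y : Rn n) (a i j : Fin n) :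
    horiz φ a (fun x' y' ↦ fund φ x' y' i j) x y
      = dx a (fun x' y' ↦ fund φ x' y' i j) x y
        - ∑ m, nonlinear φ x y m a * fundDeriv φ x y m i j := rfl

namespace IsLocalFinsler

variable {U : Set (Rn n)} {φ : Rn n → Rn n → ℝ} (H : IsLocalFinsler U φ) {x y : Rn n}

include H in
lemma smooth_sq : SlitSmooth U (fun x y ↦ φ x y ^ 2) := ContDiffOn.pow H.smooth 2

include H in
lemma smooth_fund (i j : Fin n) : SlitSmooth U (fun x y ↦ fund φ x y i j) :=
  contDiffOn_const.mul ((H.smooth_sq.dy H.isOpen j).dy H.isOpen i)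

include H in
lemma fund_symm (hx : x ∈ U) (hy : y ≠ 0) (i j : Fin n) : fund φ x y i j = fund φ x y j i := by
  simp only [fund, Matrix.of_apply]
  rw [H.smooth_sq.dy_comm H.isOpen hx hy]

include H in
lemma fundDeriv_eq (hx : x ∈ U) (hy : y ≠ 0) (k i j : Fin n) :
    fundDeriv φ x y k i j = (1 / 2) * dy k (dy i (dy j fun x y ↦ φ x y ^ 2)) x y := by
  have h := ((H.smooth_sq.dy H.isOpen j).dy H.isOpen i).differentiableAt_right H.isOpen hx hy
  change fderiv ℝ (fun y' ↦ (1 / 2 : ℝ) * dy i (dy j fun x y ↦ φ x y ^ 2) x y') y _ = _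
  rw [fderiv_const_mul h]
  rfl

include H in
lemma fundDeriv_swap_right (hx : x ∈ U) (hy : y ≠ 0) (k i j : Fin n) :
    fundDeriv φ x y k i j = fundDeriv φ x y k j i :=
  dy_congr (f := fun x' y' ↦ fund φ x' y' i j) (g := fun x' y' ↦ fund φ x' y' j i) hy
    (fun _ hz ↦ H.fund_symm hx hz i j) k

include H in
-- Up to a factor, `∂g_{ij}/∂yᵏ` is a third derivative of `φ²`. With `fundDeriv_swap_right` it is
-- totally symmetric, so contraction with `y` may be studied in any one slot.
lemma fundDeriv_swap_left (hx : x ∈ U) (hy : y ≠ 0) (k i j : Fin n) :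
    fundDeriv φ x y k i j = fundDeriv φ x y i k j := by
  rw [H.fundDeriv_eq hx hy, H.fundDeriv_eq hx hy,
    (H.smooth_sq.dy H.isOpen j).dy_comm H.isOpen hx hy]

include H in
lemma sq_hom (hx : x ∈ U) (z : Rn n) (c : ℝ) (hc : 0 < c) :
    φ x (c • z) ^ 2 = c ^ 2 * φ x z ^ 2 := by
  rw [H.hom x hx z c hc, mul_pow]

include H in
lemma dy_sq_hom (hx : x ∈ U) (k : Fin n) {z : Rn n} (hz : z ≠ 0) {c : ℝ} (hc : 0 < c) :
    dy k (fun x y ↦ φ x y ^ 2) x (c • z) = c ^ 1 * dy k (fun x y ↦ φ x y ^ 2) x z :=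
  dy_homogeneous (f := fun x y ↦ φ x y ^ 2) 1 (fun z _ c hc ↦ H.sq_hom hx z c hc) k hz hc

include H in
lemma fund_hom (hx : x ∈ U) {z : Rn n} (hz : z ≠ 0) {c : ℝ} (hc : 0 < c) :
    fund φ x (c • z) = fund φ x z := by
  ext i j
  simp only [fund, Matrix.of_apply]
  rw [dy_homogeneous 0 (fun z hz c hc ↦ H.dy_sq_hom hx j hz hc) i hz hc]
  simp

include H in
-- Euler's identity in degree `0`: the fundamental tensor is constant along rays.
lemma sum_fundDeriv_left (hx : x ∈ U) (hy : y ≠ 0) (i j : Fin n) :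
    ∑ k, y k * fundDeriv φ x y k i j = 0 := by
  have := euler (H.smooth_fund i j) H.isOpen hx hy 0
    (fun c hc ↦ by simp only [H.fund_hom hx hy hc, pow_zero, one_mul])
  rwa [Nat.cast_zero, zero_mul] at this

include H in
lemma sum_fundDeriv_mid (hx : x ∈ U) (hy : y ≠ 0) (k j : Fin n) :
    ∑ i, y i * fundDeriv φ x y k i j = 0 := by
  simp_rw [fun i ↦ H.fundDeriv_swap_left hx hy k i j]
  exact H.sum_fundDeriv_left hx hy k j

include H in
lemma sum_fundDeriv_right (hx : x ∈ U) (hy : y ≠ 0) (k i : Fin n) :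
    ∑ j, y j * fundDeriv φ x y k i j = 0 := by
  simp_rw [fun j ↦ H.fundDeriv_swap_right hx hy k i j]
  exact H.sum_fundDeriv_mid hx hy k i

include H in
lemma sum_fund (hx : x ∈ U) (hy : y ≠ 0) (j : Fin n) :
    ∑ i, y i * fund φ x y i j = (1 / 2) * dy j (fun x y ↦ φ x y ^ 2) x y := by
  have := euler (H.smooth_sq.dy H.isOpen j) H.isOpen hx hy 1 (fun c hc ↦ H.dy_sq_hom hx j hy hc)
  simp only [Nat.cast_one, one_mul] at this
  rw [← this, Finset.mul_sum]
  exact Finset.sum_congr rfl fun i _ ↦ by simp only [fund, Matrix.of_apply]; ring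

include H in
lemma sum_sum_fund (hx : x ∈ U) (hy : y ≠ 0) :
    ∑ j, ∑ i, y i * y j * fund φ x y i j = φ x y ^ 2 := by
  have := euler H.smooth_sq H.isOpen hx hy 2 (fun c hc ↦ H.sq_hom hx y c hc)
  have h2 (j) : ∑ i, y i * y j * fund φ x y i j = y j * ∑ i, y i * fund φ x y i j := by
    rw [Finset.mul_sum]
    exact Finset.sum_congr rfl fun _ _ ↦ by ring
  simp_rw [h2, H.sum_fund hx hy]
  have h3 : ∑ j, y j * ((1 / 2) * dy j (fun x y ↦ φ x y ^ 2) x y)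
      = (1 / 2) * ∑ j, y j * dy j (fun x y ↦ φ x y ^ 2) x y := by
    rw [Finset.mul_sum]
    exact Finset.sum_congr rfl fun _ _ ↦ by ring
  rw [h3, this]
  push_cast
  ring

include H in
-- Applying Euler's identity twice gives `g_{ij} yⁱ yʲ = φ²`, so positive definiteness forces `φ ≠
-- 0`.
lemma pos (hx : x ∈ U) (hy : y ≠ 0) : 0 < φ x y := by
  have h := (H.posDef x hx y hy).dotProduct_mulVec_pos (x := fun i ↦ y i) (by
    intro h0; apply hy; ext i; exact congrFun h0 i)
  have h2 : star (fun i ↦ y i) ⬝ᵥ (fund φ x y).mulVec (fun i ↦ y i) = φ x y ^ 2 := by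
    rw [← H.sum_sum_fund hx hy, Finset.sum_comm]
    simp only [dotProduct, Matrix.mulVec, Finset.mul_sum, Pi.star_apply, star_trivial]
    exact Finset.sum_congr rfl fun i _ ↦ Finset.sum_congr rfl fun j _ ↦ by ring
  rw [h2] at h
  exact lt_of_le_of_ne (H.nonneg x y) fun h0 ↦ by rw [← h0] at h; simp at h

include H in
lemma fund_mul_inv (hx : x ∈ U) (hy : y ≠ 0) (i j : Fin n) :
    ∑ s, fund φ x y i s * (fund φ x y)⁻¹ s j = if i = j then 1 else 0 := by
  have h := Matrix.mul_nonsing_inv (fund φ x y) (H.posDef x hx y hy).det_pos.ne'.isUnit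
  have := congrFun (congrFun h i) j
  rw [Matrix.mul_apply, Matrix.one_apply] at this
  exact this

/-- The spray coefficients `Gᵏ = γᵏ_{rs} yʳ yˢ`. -/
def _root_.NatCoord.spray (φ : Rn n → Rn n → ℝ) (x y : Rn n) (k : Fin n) : ℝ :=
  ∑ r, ∑ s, formalChristoffel φ x y k r s * y r * y s

include H in
-- The factor `φ / 2` in the Cartan tensor cancels the remaining powers of `φ`, leaving `N` in terms
-- of `γ`, the `y`-derivatives of `g` and the spray.
lemma nonlinear_eq (hx : x ∈ U) (hy : y ≠ 0) (i j : Fin n) :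
    nonlinear φ x y i j = ∑ k, formalChristoffel φ x y i j k * y k
      - (1 / 2) * ∑ l, (fund φ x y)⁻¹ i l * ∑ k, fundDeriv φ x y k l j * spray φ x y k := by
  have hφ := (H.pos hx hy).ne'
  have h1 (k r s) : cartanUp φ x y i j k * formalChristoffel φ x y k r s * (y r / φ x y)
      * (y s / φ x y) = (1 / φ x y ^ 2) * (cartanUp φ x y i j k
        * (formalChristoffel φ x y k r s * y r * y s)) := by field_simp
  have h2 (k) : formalChristoffel φ x y i j k * (y k / φ x y)
      = (1 / φ x y) * (formalChristoffel φ x y i j k * y k) := by field_simp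
  have h3 (k) : cartanUp φ x y i j k * spray φ x y k
      = (φ x y / 2) * ∑ l, (fund φ x y)⁻¹ i l * (fundDeriv φ x y k l j * spray φ x y k) := by
    simp only [cartanUp, cartan, Finset.sum_mul, Finset.mul_sum]
    exact Finset.sum_congr rfl fun l _ ↦ by rw [fundDeriv]; ring
  simp only [nonlinear, h1, h2, ← Finset.mul_sum]
  change φ x y * (1 / φ x y * ∑ k, formalChristoffel φ x y i j k * y k
    - 1 / φ x y ^ 2 * ∑ k, cartanUp φ x y i j k * spray φ x y k) = _
  simp_rw [h3, ← Finset.mul_sum]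
  rw [Finset.sum_comm]
  simp_rw [← Finset.mul_sum]
  field_simp

include H in
-- The Cartan term of `N` vanishes on contraction with `y`.
lemma sum_nonlinear (hx : x ∈ U) (hy : y ≠ 0) (i : Fin n) :
    ∑ j, y j * nonlinear φ x y i j = spray φ x y i := by
  simp only [H.nonlinear_eq hx hy, mul_sub, Finset.sum_sub_distrib]
  have h1 : ∑ j, y j * ((1 / 2) * ∑ l, (fund φ x y)⁻¹ i l * ∑ k,
      fundDeriv φ x y k l j * spray φ x y k)
      = (1 / 2) * ∑ l, (fund φ x y)⁻¹ i l * ∑ k, (∑ j, y j * fundDeriv φ x y k l j)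
        * spray φ x y k := by
    simp only [Finset.mul_sum, Finset.sum_mul]
    rw [Finset.sum_comm]
    refine Finset.sum_congr rfl fun l _ ↦ ?_
    rw [Finset.sum_comm]
    exact Finset.sum_congr rfl fun k _ ↦ Finset.sum_congr rfl fun j _ ↦ by ring
  rw [h1]
  simp only [H.sum_fundDeriv_right hx hy, zero_mul, Finset.sum_const_zero, mul_zero, sub_zero]
  simp only [spray, Finset.mul_sum]
  exact Finset.sum_congr rfl fun j _ ↦ Finset.sum_congr rfl fun k _ ↦ by ring

include H in
/-- `Γⁱ_{jk} yᵏ = Nⁱ_j`. -/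
lemma sum_chern (hx : x ∈ U) (hy : y ≠ 0) (i j : Fin n) :
    ∑ k, chern φ x y i j k * y k = nonlinear φ x y i j := by
  have h0 (s : Fin n) : ∑ k, (horiz φ k (fun x' y' ↦ fund φ x' y' s j) x y
        - horiz φ s (fun x' y' ↦ fund φ x' y' j k) x y
        + horiz φ j (fun x' y' ↦ fund φ x' y' s k) x y) * y k
      = ∑ k, (dx k (fun x' y' ↦ fund φ x' y' s j) x y - dx s (fun x' y' ↦ fund φ x' y' j k) x y
        + dx j (fun x' y' ↦ fund φ x' y' s k) x y) * y k
        - ∑ m, fundDeriv φ x y m s j * spray φ x y m := by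
    -- Of the three vertical corrections only the one in `δg_{sj}/δxᵏ` survives: there `Nᵐ_k yᵏ`
    -- becomes the spray, which reproduces the Cartan term of `N`. In the other two, `y` is
    -- contracted into `∂g/∂y` (`e2`).
    have e1 : ∑ k, (∑ m, nonlinear φ x y m k * fundDeriv φ x y m s j) * y k
        = ∑ m, fundDeriv φ x y m s j * spray φ x y m := by
      simp_rw [← fun i ↦ H.sum_nonlinear hx hy i, Finset.sum_mul, Finset.mul_sum]
      rw [Finset.sum_comm]
      exact Finset.sum_congr rfl fun m _ ↦ Finset.sum_congr rfl fun k _ ↦ by ring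
    have e2 (a b : Fin n) : ∑ k, (∑ m, nonlinear φ x y m a * fundDeriv φ x y m b k) * y k = 0 := by
      simp_rw [Finset.sum_mul]
      rw [Finset.sum_comm]
      refine Finset.sum_eq_zero fun m _ ↦ ?_
      have : ∑ k, nonlinear φ x y m a * fundDeriv φ x y m b k * y k
          = nonlinear φ x y m a * ∑ k, y k * fundDeriv φ x y m b k := by
        rw [Finset.mul_sum]
        exact Finset.sum_congr rfl fun _ _ ↦ by ring
      rw [this, H.sum_fundDeriv_right hx hy, mul_zero]
    rw [← e1]
    have h3 := e2 s j
    have h4 := e2 j s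
    simp only [horiz_fund, add_mul, sub_mul, Finset.sum_add_distrib,
      Finset.sum_sub_distrib, h3, h4]
    ring
  have h1 : ∑ k, chern φ x y i j k * y k = (1 / 2) * ∑ s, (fund φ x y)⁻¹ i s *
      ∑ k, (horiz φ k (fun x' y' ↦ fund φ x' y' s j) x y
        - horiz φ s (fun x' y' ↦ fund φ x' y' j k) x y
        + horiz φ j (fun x' y' ↦ fund φ x' y' s k) x y) * y k := by
    simp only [chern, Finset.mul_sum, Finset.sum_mul]
    rw [Finset.sum_comm]
    exact Finset.sum_congr rfl fun m _ ↦ Finset.sum_congr rfl fun k _ ↦ by ring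
  have h2 : ∑ k, formalChristoffel φ x y i j k * y k = (1 / 2) * ∑ s, (fund φ x y)⁻¹ i s *
      ∑ k, (dx k (fun x' y' ↦ fund φ x' y' s j) x y - dx s (fun x' y' ↦ fund φ x' y' j k) x y
        + dx j (fun x' y' ↦ fund φ x' y' s k) x y) * y k := by
    simp only [formalChristoffel, Finset.mul_sum, Finset.sum_mul]
    rw [Finset.sum_comm]
    exact Finset.sum_congr rfl fun m _ ↦ Finset.sum_congr rfl fun k _ ↦ by ring
  rw [h1, H.nonlinear_eq hx hy, h2]
  simp only [h0, mul_sub, Finset.sum_sub_distrib]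

include H in
lemma horiz_fund_symm (hx : x ∈ U) (hy : y ≠ 0) (a i j : Fin n) :
    horiz φ a (fun x' y' ↦ fund φ x' y' i j) x y
      = horiz φ a (fun x' y' ↦ fund φ x' y' j i) x y := by
  have h1 : dx a (fun x' y' ↦ fund φ x' y' i j) x y = dx a (fun x' y' ↦ fund φ x' y' j i) x y :=
    dx_congr H.isOpen hx (fun z hz ↦ H.fund_symm hz hy i j) a
  simp only [horiz_fund, h1, fun m ↦ H.fundDeriv_swap_right hx hy m i j]

include H in
-- Exchanging `j` and `k` swaps the outer two terms of the bracket and fixes the middle one, because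
-- `g` is symmetric. The Berwald hypothesis plays no role.
lemma chern_symm (hx : x ∈ U) (hy : y ≠ 0) (i j k : Fin n) :
    chern φ x y i j k = chern φ x y i k j := by
  simp only [chern]
  congr 1
  refine Finset.sum_congr rfl fun s _ ↦ ?_
  rw [H.horiz_fund_symm hx hy s k j]
  ring

include H in
/-- The horizontal derivatives of `φ` vanish. -/
lemma horiz_self (hx : x ∈ U) (hy : y ≠ 0) (j : Fin n) : horiz φ j φ x y = 0 := by
  have hφ := (H.pos hx hy).ne'
  have e1 : dx j (fun x y ↦ φ x y ^ 2) x y = 2 * φ x y * dx j φ x y := by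
    have := (H.smooth.differentiableAt_left H.isOpen hx hy).hasFDerivAt.pow 2
    simp only [dx]
    rw [this.fderiv]
    simp
  have e2 (i) : dy i (fun x y ↦ φ x y ^ 2) x y = 2 * φ x y * dy i φ x y := by
    have := (H.smooth.differentiableAt_right H.isOpen hx hy).hasFDerivAt.pow 2
    simp only [dy]
    rw [this.fderiv]
    simp
  have e3 : dx j (fun x y ↦ φ x y ^ 2) x y
      = ∑ b, ∑ a, y a * y b * dx j (fun x y ↦ fund φ x y a b) x y := by
    rw [dx_congr H.isOpen hx (g := fun x y ↦ ∑ b, ∑ a, y a * y b * fund φ x y a b)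
      (fun z hz ↦ (H.sum_sum_fund hz hy).symm) j]
    have hd (a b) := (H.smooth_fund a b).differentiableAt_left H.isOpen hx hy
    have : HasFDerivAt (fun x' ↦ ∑ b, ∑ a, y a * y b * fund φ x' y a b)
        (∑ b, ∑ a, (y a * y b) • fderiv ℝ (fun x' ↦ fund φ x' y a b) x) x :=
      HasFDerivAt.fun_sum fun b _ ↦ HasFDerivAt.fun_sum fun a _ ↦
        (hd a b).hasFDerivAt.const_mul _
    simp only [dx]
    rw [this.fderiv]
    simp
  -- Here `∂φ²/∂yⁱ = 2 g_{ai} yᵃ`, so the sum lowers the upper index of `N` against `y` and cancels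
  -- the inverse matrix (`lower`). The Cartan term dies by Euler (`a3`), and two of the three terms
  -- of `γ` cancel by symmetry (`a4`). What is left is `yᵏ yˢ ∂g_{ks}/∂xʲ = ∂φ²/∂xʲ`.
  have e4 : ∑ i, nonlinear φ x y i j * dy i (fun x y ↦ φ x y ^ 2) x y
      = dx j (fun x y ↦ φ x y ^ 2) x y := by
    have a1 (i) : dy i (fun x y ↦ φ x y ^ 2) x y = 2 * ∑ a, y a * fund φ x y a i := by
      rw [H.sum_fund hx hy]; ring
    have lower (V : Fin n → ℝ) : ∑ i, (∑ s, (fund φ x y)⁻¹ i s * V s)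
        * ∑ a, y a * fund φ x y a i = ∑ s, y s * V s := by
      have : ∑ i, (∑ s, (fund φ x y)⁻¹ i s * V s) * ∑ a, y a * fund φ x y a i
          = ∑ s, V s * ∑ a, y a * ∑ i, fund φ x y a i * (fund φ x y)⁻¹ i s := by
        calc _ = ∑ i, ∑ s, ∑ a, ((fund φ x y)⁻¹ i s * V s) * (y a * fund φ x y a i) :=
              Finset.sum_congr rfl fun i _ ↦ Finset.sum_mul_sum _ _ _ _
          _ = ∑ s, ∑ i, ∑ a, ((fund φ x y)⁻¹ i s * V s) * (y a * fund φ x y a i) :=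
              Finset.sum_comm
          _ = ∑ s, ∑ a, ∑ i, ((fund φ x y)⁻¹ i s * V s) * (y a * fund φ x y a i) :=
              Finset.sum_congr rfl fun _ _ ↦ Finset.sum_comm
          _ = _ := by
              simp only [Finset.mul_sum]
              exact Finset.sum_congr rfl fun _ _ ↦ Finset.sum_congr rfl fun _ _ ↦
                Finset.sum_congr rfl fun _ _ ↦ by ring
      rw [this]
      simp only [H.fund_mul_inv hx hy]
      simp [mul_comm]
    have a2 (i) : nonlinear φ x y i j = ∑ s, (fund φ x y)⁻¹ i s * ((1 / 2) *
        (∑ k, (dx k (fun x' y' ↦ fund φ x' y' s j) x y - dx s (fun x' y' ↦ fund φ x' y' j k) x y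
          + dx j (fun x' y' ↦ fund φ x' y' s k) x y) * y k
        - ∑ k, fundDeriv φ x y k s j * spray φ x y k)) := by
      have h2 : ∑ k, formalChristoffel φ x y i j k * y k = ∑ s, (fund φ x y)⁻¹ i s * ((1 / 2) *
          ∑ k, (dx k (fun x' y' ↦ fund φ x' y' s j) x y
          - dx s (fun x' y' ↦ fund φ x' y' j k) x y
          + dx j (fun x' y' ↦ fund φ x' y' s k) x y) * y k) := by
        simp only [formalChristoffel, Finset.mul_sum, Finset.sum_mul]
        rw [Finset.sum_comm]
        exact Finset.sum_congr rfl fun m _ ↦ Finset.sum_congr rfl fun k _ ↦ by ring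
      rw [H.nonlinear_eq hx hy, h2, Finset.mul_sum, ← Finset.sum_sub_distrib]
      exact Finset.sum_congr rfl fun _ _ ↦ by ring
    have a3 : ∑ s, y s * ∑ k, fundDeriv φ x y k s j * spray φ x y k = 0 := by
      have : ∑ s, y s * ∑ k, fundDeriv φ x y k s j * spray φ x y k
          = ∑ k, (∑ s, y s * fundDeriv φ x y k s j) * spray φ x y k := by
        simp only [Finset.mul_sum, Finset.sum_mul]
        rw [Finset.sum_comm]
        exact Finset.sum_congr rfl fun _ _ ↦ Finset.sum_congr rfl fun _ _ ↦ by ring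
      simp [this, H.sum_fundDeriv_mid hx hy]
    have a4 : ∑ s, y s * ∑ k, (dx k (fun x' y' ↦ fund φ x' y' s j) x y
          - dx s (fun x' y' ↦ fund φ x' y' j k) x y
          + dx j (fun x' y' ↦ fund φ x' y' s k) x y) * y k
        = ∑ s, ∑ k, y k * y s * dx j (fun x' y' ↦ fund φ x' y' k s) x y := by
      have b1 (s k) : dx s (fun x' y' ↦ fund φ x' y' j k) x y
          = dx s (fun x' y' ↦ fund φ x' y' k j) x y :=
        dx_congr H.isOpen hx (fun z hz ↦ H.fund_symm hz hy j k) s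
      have b2 (s k) : dx j (fun x' y' ↦ fund φ x' y' s k) x y
          = dx j (fun x' y' ↦ fund φ x' y' k s) x y :=
        dx_congr H.isOpen hx (fun z hz ↦ H.fund_symm hz hy s k) j
      have b3 : ∑ s, ∑ k, y s * y k * dx k (fun x' y' ↦ fund φ x' y' s j) x y
          = ∑ s, ∑ k, y s * y k * dx s (fun x' y' ↦ fund φ x' y' k j) x y := by
        rw [Finset.sum_comm]
        exact Finset.sum_congr rfl fun _ _ ↦ Finset.sum_congr rfl fun _ _ ↦ by ring
      have b4 (s) : y s * ∑ k, (dx k (fun x' y' ↦ fund φ x' y' s j) x y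
          - dx s (fun x' y' ↦ fund φ x' y' j k) x y
          + dx j (fun x' y' ↦ fund φ x' y' s k) x y) * y k
          = ∑ k, y s * y k * dx k (fun x' y' ↦ fund φ x' y' s j) x y
            - ∑ k, y s * y k * dx s (fun x' y' ↦ fund φ x' y' k j) x y
            + ∑ k, y k * y s * dx j (fun x' y' ↦ fund φ x' y' k s) x y := by
        rw [← Finset.sum_sub_distrib, ← Finset.sum_add_distrib, Finset.mul_sum]
        exact Finset.sum_congr rfl fun k _ ↦ by rw [b1, b2]; ring
      simp only [b4, Finset.sum_add_distrib, Finset.sum_sub_distrib]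
      rw [b3]
      ring
    calc ∑ i, nonlinear φ x y i j * dy i (fun x y ↦ φ x y ^ 2) x y
        = 2 * ∑ i, nonlinear φ x y i j * ∑ a, y a * fund φ x y a i := by
          rw [Finset.mul_sum]
          exact Finset.sum_congr rfl fun i _ ↦ by rw [a1]; ring
      _ = _ := by
          simp only [a2]
          rw [lower, e3]
          simp only [mul_sub, Finset.sum_sub_distrib, mul_left_comm _ (1 / 2 : ℝ), a3, a4,
            ← Finset.mul_sum]
          ring
  have e5 : ∑ i, nonlinear φ x y i j * dy i (fun x y ↦ φ x y ^ 2) x y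
      = 2 * φ x y * ∑ i, nonlinear φ x y i j * dy i φ x y := by
    rw [Finset.mul_sum]
    exact Finset.sum_congr rfl fun i _ ↦ by rw [e2]; ring
  -- This is `δ(φ²)/δxʲ = 0`; the factor `2 φ` is then divided out.
  have : 2 * φ x y * horiz φ j φ x y = 0 := by
    rw [horiz, mul_sub, ← e5, e4, e1, sub_self]
  exact (mul_eq_zero.1 this).resolve_left (by positivity)

include H in
/-- If the coefficients of the Chern connection at `x` do not depend on `y`, then the Berwald and
the Chern connection agree at `x`. -/
lemma berwald_eq_chern (hx : x ∈ U)
    (hB : ∀ y z : Rn n, y ≠ 0 → z ≠ 0 → chern φ x y = chern φ x z) (hy : y ≠ 0) :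
    berwald φ x y = chern φ x y := by
  ext i j k
  -- `Nⁱ_j = Γⁱ_{jk} y'ᵏ`, with `Γ` frozen at `y`, holds at every `y' ≠ 0`; thus `N` is linear near
  -- `y` and its derivative is `Γ`.
  rw [berwald, dy_congr (g := fun _ y' ↦ ∑ k, chern φ x y i j k * y' k) hy (fun z hz ↦ by
    rw [← H.sum_chern hx hz, hB z y hz hy])]
  have : HasFDerivAt (fun y' : Rn n ↦ ∑ k, chern φ x y i j k * y' k)
      (∑ k, chern φ x y i j k • (EuclideanSpace.proj k : Rn n →L[ℝ] ℝ)) y :=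
    HasFDerivAt.fun_sum fun k _ ↦
      (EuclideanSpace.proj k : Rn n →L[ℝ] ℝ).hasFDerivAt.const_mul _
  rw [dy, this.fderiv]
  simp

end IsLocalFinsler

end NatCoord

/-! ### Coordinate fields, components, and passage from the manifold to natural coordinates -/

section Frames

variable {n : ℕ} {M : Type*} [TopologicalSpace M] [ChartedSpace (Rn n) M]
  [IsManifold (𝓡 n) ∞ M]

/-- The local vector field around `x` with constant components `v` in the natural coordinates of
the preferred chart at `x`. -/
def frame (x : M) (v : Rn n) (p : M) : TangentSpace (𝓡 n) p :=
  (trivializationAt (Rn n) (TangentSpace (𝓡 n)) x).symmL ℝ p v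

variable {x p : M}

lemma frame_eq_symm (hp : p ∈ (chartAt (Rn n) x).source) (v : Rn n) :
    frame x v p = (trivializationAt (Rn n) (TangentSpace (𝓡 n)) x).symm p v :=
  Trivialization.symmL_apply _ (by exact hp) v

lemma comps_frame (hp : p ∈ (chartAt (Rn n) x).source) (v : Rn n) :
    comps x ⟨p, frame x v p⟩ = v := by
  rw [frame_eq_symm hp, comps, Trivialization.apply_mk_symm _ (by exact hp)]

lemma frame_comps (hp : p ∈ (chartAt (Rn n) x).source) (w : TangentSpace (𝓡 n) p) :
    frame x (comps x ⟨p, w⟩) p = w := by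
  rw [frame_eq_symm hp]
  exact Trivialization.symm_apply_apply_mk _ (by exact hp) w

/-- The preferred chart at `x` is the one used to identify `T_xM` with `ℝⁿ`, so the coordinate
change at `x` itself is the identity. -/
lemma comps_self (x : M) (w : TangentSpace (𝓡 n) x) : comps x ⟨x, w⟩ = w :=
  (tangentBundleCore (𝓡 n) M).coordChange_self (achart (Rn n) x) x
    (mem_chart_source (Rn n) x) w

lemma frame_self (x : M) (v : Rn n) : frame x v x = v := by
  have h := comps_frame (mem_chart_source (Rn n) x) v
  exact (comps_self x (frame x v x)).symm.trans h

/-- Fields of the form `FiberBundle.extend` are locally coordinate fields, so everything proved for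
`frame` applies to them. -/
lemma extend_eventuallyEq_frame (w : TangentSpace (𝓡 n) x) :
    ∀ᶠ p in nhds x, FiberBundle.extend (Rn n) w p = frame x w p := by
  filter_upwards [(chartAt (Rn n) x).open_source.mem_nhds (mem_chart_source (Rn n) x)] with p hp
  refine Eq.trans ?_ (frame_eq_symm hp (show Rn n from w)).symm
  change (trivializationAt (Rn n) (TangentSpace (𝓡 n)) x).symm p (comps x ⟨x, w⟩) = _
  rw [comps_self]

lemma frame_add (x : M) (v w : Rn n) : frame x (v + w) = frame x v + frame x w := by
  funext p
  exact ((trivializationAt (Rn n) (TangentSpace (𝓡 n)) x).symmL ℝ p).map_add v w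

lemma frame_smul (x : M) (c : ℝ) (v : Rn n) : frame x (c • v) = c • frame x v := by
  funext p
  exact ((trivializationAt (Rn n) (TangentSpace (𝓡 n)) x).symmL ℝ p).map_smul c v

lemma comps_eq (hp : p ∈ (chartAt (Rn n) x).source) (w : TangentSpace (𝓡 n) p) :
    comps x ⟨p, w⟩
      = (trivializationAt (Rn n) (TangentSpace (𝓡 n)) x).continuousLinearMapAt ℝ p w := by
  rw [Trivialization.continuousLinearMapAt_apply, Trivialization.coe_linearMapAt_of_mem _ hp]
  rfl

lemma comps_add (hp : p ∈ (chartAt (Rn n) x).source) (v w : TangentSpace (𝓡 n) p) :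
    comps x ⟨p, v + w⟩ = comps x ⟨p, v⟩ + comps x ⟨p, w⟩ := by
  simp only [comps_eq hp, map_add]

lemma comps_smul (hp : p ∈ (chartAt (Rn n) x).source) (c : ℝ) (w : TangentSpace (𝓡 n) p) :
    comps x ⟨p, c • w⟩ = c • comps x ⟨p, w⟩ := by
  simp only [comps_eq hp, map_smul]

lemma frame_eq_mfderiv (hp : p ∈ (chartAt (Rn n) x).source) (v : Rn n) :
    frame x v p = mfderiv (𝓡 n) (𝓡 n) (chartAt (Rn n) x).symm (chartAt (Rn n) x p) v := by
  have := DFunLike.congr_fun (TangentBundle.symmL_trivializationAt (I := 𝓡 n) hp) v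
  simpa only [frame, mfld_simps, mfderivWithin_univ] using! this

lemma comps_eq_mfderiv (hp : p ∈ (chartAt (Rn n) x).source) (w : TangentSpace (𝓡 n) p) :
    comps x ⟨p, w⟩ = mfderiv (𝓡 n) (𝓡 n) (chartAt (Rn n) x) p w := by
  have := DFunLike.congr_fun
    (TangentBundle.continuousLinearMapAt_trivializationAt (I := 𝓡 n) hp) w
  rw [comps_eq hp]
  simpa only [mfld_simps] using! this

omit [IsManifold (𝓡 n) ∞ M] in
lemma totalSpace_mk_congr {p q : M} (h : p = q) (w : Rn n) :
    (⟨p, w⟩ : TangentBundle (𝓡 n) M) = ⟨q, w⟩ := by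
  subst h; rfl

lemma localF_apply (F : TangentBundle (𝓡 n) M → ℝ) (hp : p ∈ (chartAt (Rn n) x).source)
    (v : Rn n) : localF F x (chartAt (Rn n) x p) v = F ⟨p, frame x v p⟩ := by
  have h := (chartAt (Rn n) x).left_inv hp
  rw [frame_eq_mfderiv hp]
  exact congrArg F (totalSpace_mk_congr h _)

lemma differentiableFieldAt_iff (hp : p ∈ (chartAt (Rn n) x).source)
    (Y : Π p : M, TangentSpace (𝓡 n) p) :
    DifferentiableFieldAt Y p ↔
      MDifferentiableAt (𝓡 n) 𝓘(ℝ, Rn n) (fun q ↦ comps x ⟨q, Y q⟩) p :=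
  Trivialization.mdifferentiableAt_section_iff (𝓡 n)
    (trivializationAt (Rn n) (TangentSpace (𝓡 n)) x) Y (by exact hp)

lemma contMDiffAt_frame (hp : p ∈ (chartAt (Rn n) x).source) (v : Rn n) :
    ContMDiffAt (𝓡 n) ((𝓡 n).prod 𝓘(ℝ, Rn n)) ∞
      (fun q ↦ TotalSpace.mk' (Rn n) (E := fun p : M ↦ TangentSpace (𝓡 n) p) q (frame x v q))
      p := by
  rw [Trivialization.contMDiffAt_section_iff
    (trivializationAt (Rn n) (TangentSpace (𝓡 n)) x) (by exact hp)]
  refine (contMDiffAt_const (c := v)).congr_of_eventuallyEq ?_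
  filter_upwards [(chartAt (Rn n) x).open_source.mem_nhds hp] with q hq
  exact comps_frame hq v

lemma differentiableFieldAt_frame (hp : p ∈ (chartAt (Rn n) x).source) (v : Rn n) :
    DifferentiableFieldAt (frame x v) p :=
  (contMDiffAt_frame hp v).mdifferentiableAt (by simp)

/-- In coordinates `F` is its composition with the inverse of the tangent trivialization. That
inverse is smooth and fibrewise injective, so it maps the slit domain into the slit tangent bundle.
-/
lemma slitSmooth_localF {F : TangentBundle (𝓡 n) M → ℝ} (hF : IsFinsler F) (x : M) :
    NatCoord.SlitSmooth (chartAt (Rn n) x).target (localF F x) := by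
  set T := trivializationAt (Rn n) (TangentSpace (𝓡 n) : M → Type _) x
  set e := chartAt (Rn n) x
  have h1 : ContMDiffOn 𝓘(ℝ, Rn n × Rn n) ((𝓡 n).prod 𝓘(ℝ, Rn n)) ∞
      (fun q : Rn n × Rn n ↦ (e.symm q.1, q.2)) (e.target ×ˢ {0}ᶜ) :=
    ((contMDiffOn_chart_symm (x := x)).comp contDiff_fst.contMDiff.contMDiffOn
      fun q hq ↦ hq.1).prodMk contDiff_snd.contMDiff.contMDiffOn
  have h2 : ContMDiffOn 𝓘(ℝ, Rn n × Rn n) ((𝓡 n).prod 𝓘(ℝ, Rn n)) ∞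
      (fun q : Rn n × Rn n ↦ T.toOpenPartialHomeomorph.symm (e.symm q.1, q.2))
      (e.target ×ˢ {0}ᶜ) :=
    (T.contMDiffOn_symm (n := ∞) (IB := 𝓡 n)).comp h1 fun q hq ↦
      T.mem_target.2 (e.map_target hq.1)
  have h3 : ∀ q ∈ e.target ×ˢ ({0}ᶜ : Set (Rn n)),
      T.toOpenPartialHomeomorph.symm (e.symm q.1, q.2)
        = ⟨e.symm q.1, frame x q.2 (e.symm q.1)⟩ := fun q hq ↦ by
    rw [frame_eq_symm (e.map_target hq.1)]
    exact (T.mk_symm (e.map_target hq.1) q.2).symm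
  have h4 : MapsTo (fun q : Rn n × Rn n ↦ T.toOpenPartialHomeomorph.symm (e.symm q.1, q.2))
      (e.target ×ˢ {0}ᶜ) {p | p.2 ≠ 0} := fun q hq ↦ by
    change (T.toOpenPartialHomeomorph.symm (e.symm q.1, q.2)).2 ≠ 0
    rw [h3 q hq]
    intro h0
    apply hq.2
    have := comps_frame (e.map_target hq.1) q.2
    change frame x q.2 (e.symm q.1) = 0 at h0
    rw [h0, comps_eq (e.map_target hq.1), map_zero] at this
    exact this.symm
  refine ((hF.smooth.comp h2 h4).contDiffOn).congr fun q hq ↦ ?_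
  change localF F x q.1 q.2 = F (T.toOpenPartialHomeomorph.symm (e.symm q.1, q.2))
  rw [h3 q hq, ← localF_apply F (e.map_target hq.1), e.right_inv hq.1]

lemma isLocalFinsler_localF {F : TangentBundle (𝓡 n) M → ℝ} (hF : IsFinsler F) (x : M) :
    NatCoord.IsLocalFinsler (chartAt (Rn n) x).target (localF F x) where
  isOpen := (chartAt (Rn n) x).open_target
  smooth := slitSmooth_localF hF x
  nonneg _ _ := hF.nonneg _
  hom z _ y c hc := by
    have h := (mfderiv (𝓡 n) (𝓡 n) (chartAt (Rn n) x).symm z).map_smul c y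
    exact (congrArg (fun w ↦ F ⟨_, w⟩) h).trans (hF.homogeneous _ _ c hc)
  posDef := hF.convex _ (IsManifold.chart_mem_maximalAtlas x)

end Frames

/-! ### Affine connections in coordinates and the Koszul formula -/

section Connections

variable {n : ℕ} {M : Type*} [TopologicalSpace M] [ChartedSpace (Rn n) M]
  [IsManifold (𝓡 n) ∞ M]

variable {x p : M}

lemma isManifold_two : IsManifold (𝓡 n) 2 M := .of_le (n := ∞) (by norm_cast)

lemma inverse_continuousLinearMapAt (hp : p ∈ (chartAt (Rn n) x).source) (v : Rn n) :
    ((trivializationAt (Rn n) (TangentSpace (𝓡 n)) x).continuousLinearMapAt ℝ p).inverse v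
      = frame x v p := by
  have hb : p ∈ (trivializationAt (Rn n) (TangentSpace (𝓡 n)) x).baseSet := hp
  rw [← Trivialization.coe_continuousLinearEquivAt_eq' _ hb, ContinuousLinearMap.inverse_equiv,
    Trivialization.symm_continuousLinearEquivAt_eq' _ hb]
  rfl

/-- The constant vector field on the model space. -/
def constField (v : Rn n) : Π y : Rn n, TangentSpace 𝓘(ℝ, Rn n) y := fun _ ↦ v

lemma frame_eventuallyEq_mpullback (hp : p ∈ (chartAt (Rn n) x).source) (v : Rn n) :
    frame x v =ᶠ[nhds p] VectorField.mpullback (𝓡 n) 𝓘(ℝ, Rn n) (extChartAt (𝓡 n) x)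
      (constField v) := by
  filter_upwards [(chartAt (Rn n) x).open_source.mem_nhds hp] with q hq
  rw [VectorField.mpullback_apply, ← TangentBundle.continuousLinearMapAt_trivializationAt hq]
  exact (inverse_continuousLinearMapAt hq v).symm

/-- Coordinate fields are pullbacks of constant fields by the chart, and Lie brackets commute with
pullback. -/
lemma mlieBracket_frame (hp : p ∈ (chartAt (Rn n) x).source) (v w : Rn n) :
    VectorField.mlieBracket (𝓡 n) (frame x v) (frame x w) p = 0 := by
  have : IsManifold (𝓡 n) (minSmoothness ℝ 2) M := by simpa using isManifold_two
  have hd (v : Rn n) (y : Rn n) : MDifferentiableAt 𝓘(ℝ, Rn n) (𝓘(ℝ, Rn n).prod 𝓘(ℝ, Rn n))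
      (fun z ↦ (TotalSpace.mk' (Rn n) z (constField v z) : TangentBundle 𝓘(ℝ, Rn n) (Rn n))) y :=
    ((contMDiffAt_vectorSpace_iff_contDiffAt (n := 1)).2
      (contDiffAt_const (c := v))).mdifferentiableAt (by simp)
  have hb (v w : Rn n) : VectorField.mlieBracket 𝓘(ℝ, Rn n) (constField v) (constField w) = 0 := by
    rw [← VectorField.mlieBracketWithin_univ, VectorField.mlieBracketWithin_eq_lieBracketWithin]
    funext y
    change fderivWithin ℝ (fun _ : Rn n ↦ w) univ y v
      - fderivWithin ℝ (fun _ : Rn n ↦ v) univ y w = 0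
    simp
  rw [(frame_eventuallyEq_mpullback hp v).mlieBracket_vectorField_eq
    (frame_eventuallyEq_mpullback hp w), ← VectorField.mpullback_mlieBracket
    (n := minSmoothness ℝ 2) (hd v _) (hd w _) (contMDiffAt_extChartAt' hp) le_rfl, hb,
    VectorField.mpullback_zero]
  rfl

lemma mvfderiv_comps_frame (hp : p ∈ (chartAt (Rn n) x).source) (v : Rn n) :
    mvfderiv (𝓡 n) (fun q ↦ comps x ⟨q, frame x v q⟩) p = 0 := by
  have h : (fun q ↦ comps x ⟨q, frame x v q⟩) =ᶠ[nhds p] fun _ ↦ v := by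
    filter_upwards [(chartAt (Rn n) x).open_source.mem_nhds hp] with q hq
    exact comps_frame hq v
  rw [mvfderiv, h.mfderiv_eq, mfderiv_const]
  exact ContinuousLinearMap.comp_zero _

/-- The local formula for a connection. -/
lemma comps_nabla (nabla : AffineConnection n M) (hp : p ∈ (chartAt (Rn n) x).source)
    {Y : Π p : M, TangentSpace (𝓡 n) p} (hY : DifferentiableFieldAt Y p)
    (X : TangentSpace (𝓡 n) p) :
    comps x ⟨p, nabla Y p X⟩ = mvfderiv (𝓡 n) (fun q ↦ comps x ⟨q, Y q⟩) p X
      + comps x ⟨p, nabla (frame x (comps x ⟨p, Y p⟩)) p X⟩ := by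
  -- The connection minus the coordinate derivative is tensorial: the Leibniz terms cancel. Its
  -- value therefore depends only on `Y p`, and `Y` may be replaced by the coordinate field through
  -- `Y p`, whose coordinate derivative vanishes.
  have hT : TensorialAt (𝓡 n) (Rn n) (fun Y : Π p : M, TangentSpace (𝓡 n) p ↦
      comps x ⟨p, nabla Y p X⟩ - mvfderiv (𝓡 n) (fun q ↦ comps x ⟨q, Y q⟩) p X) p := by
    constructor
    · intro f σ hf hσ
      have hσ' := (differentiableFieldAt_iff hp σ).1 hσ
      have e : (fun q ↦ comps x ⟨q, (f • σ) q⟩) =ᶠ[nhds p] f • fun q ↦ comps x ⟨q, σ q⟩ := by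
        filter_upwards [(chartAt (Rn n) x).open_source.mem_nhds hp] with q hq
        exact comps_smul hq _ _
      have e2 : mvfderiv (𝓡 n) (fun q ↦ comps x ⟨q, (f • σ) q⟩) p X
          = mvfderiv (𝓡 n) (f • fun q ↦ comps x ⟨q, σ q⟩) p X := by
        rw [mvfderiv, mvfderiv, e.mfderiv_eq]
        rfl
      have e3 : nabla (f • σ) p X = f p • nabla σ p X + (mvfderiv (𝓡 n) f p X) • σ p := by
        rw [nabla.isCovariantDerivativeOnUniv.leibniz hσ hf]
        rfl
      rw [e2, mvfderiv_smul hf hσ', e3, comps_add hp, comps_smul hp, comps_smul hp]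
      simp
      rw [smul_sub]
    · intro σ τ hσ hτ
      have hσ' := (differentiableFieldAt_iff hp σ).1 hσ
      have hτ' := (differentiableFieldAt_iff hp τ).1 hτ
      have e : (fun q ↦ comps x ⟨q, (σ + τ) q⟩) =ᶠ[nhds p]
          (fun q ↦ comps x ⟨q, σ q⟩) + fun q ↦ comps x ⟨q, τ q⟩ := by
        filter_upwards [(chartAt (Rn n) x).open_source.mem_nhds hp] with q hq
        exact comps_add hq _ _
      have e2 : mvfderiv (𝓡 n) (fun q ↦ comps x ⟨q, (σ + τ) q⟩) p X
          = mvfderiv (𝓡 n) ((fun q ↦ comps x ⟨q, σ q⟩) + fun q ↦ comps x ⟨q, τ q⟩) p X := by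
        rw [mvfderiv, mvfderiv, e.mfderiv_eq]
        rfl
      have e3 : nabla (σ + τ) p X = nabla σ p X + nabla τ p X := by
        rw [nabla.isCovariantDerivativeOnUniv.add hσ hτ]
        rfl
      rw [e2, mvfderiv_add hσ' hτ', e3, comps_add hp]
      simp
      abel
  have h := hT.pointwise hY (differentiableFieldAt_frame hp (comps x ⟨p, Y p⟩))
    (frame_comps hp (Y p)).symm
  simp only [mvfderiv_comps_frame hp] at h
  simp only [zero_apply, sub_zero] at h
  rw [← h]
  abel

/-- The Levi-Civita property in terms of vector fields. -/
lemma isLeviCivita_iff (h : RMetric n M) (nabla : AffineConnection n M) :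
    IsLeviCivita h nabla ↔
      (∀ (p : M) (u v : TangentSpace (𝓡 n) p), nabla (FiberBundle.extend (Rn n) v) p u
          = nabla (FiberBundle.extend (Rn n) u) p v) ∧
      ∀ (p : M) (X : TangentSpace (𝓡 n) p) (Y Z : Π p : M, TangentSpace (𝓡 n) p),
        DifferentiableFieldAt Y p → DifferentiableFieldAt Z p →
        mvfderiv (𝓡 n) (fun p ↦ h.inner p (Y p) (Z p)) p X
          = h.inner p (nabla Y p X) (Z p) + h.inner p (Y p) (nabla Z p X) := by
  have : IsManifold (𝓡 n) 2 M := isManifold_two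
  let _ : RiemannianBundle (fun x : M ↦ TangentSpace (𝓡 n) x) := ⟨h.toRiemannianMetric⟩
  -- Torsion is tensorial and can be tested on the extensions of vectors. These are coordinate
  -- fields, so the bracket term disappears.
  have hbr (p : M) (u v : TangentSpace (𝓡 n) p) : VectorField.mlieBracket (𝓡 n)
      (FiberBundle.extend (Rn n) u) (FiberBundle.extend (Rn n) v) p = 0 := by
    rw [Filter.EventuallyEq.mlieBracket_vectorField_eq (extend_eventuallyEq_frame u)
      (extend_eventuallyEq_frame v)]
    exact mlieBracket_frame (mem_chart_source (Rn n) p) u v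
  have htor (p : M) (u v : TangentSpace (𝓡 n) p) : nabla.torsion p u v
      = nabla (FiberBundle.extend (Rn n) v) p u - nabla (FiberBundle.extend (Rn n) u) p v := by
    rw [CovariantDerivative.torsion_apply_eq_extend, hbr, sub_zero,
      FiberBundle.extend_apply_self, FiberBundle.extend_apply_self]
  refine and_congr ⟨fun h0 p u v ↦ ?_, fun h0 ↦ ?_⟩ ⟨fun h0 p X Y Z hY hZ ↦ ?_, fun h0 ↦ ?_⟩
  · rw [← sub_eq_zero, ← htor, h0]
    rfl
  · ext p u v : 3
    rw [htor, h0, sub_self]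
    rfl
  · have := h0.mvfderiv_inner_eq (X := FiberBundle.extend (Rn n) X) hY hZ
    simp only [FiberBundle.extend_apply_self] at this
    exact this
  · rw [CovariantDerivative.isMetricCompatible_iff]
    intro p X Y Z _ hY hZ
    exact h0 p (X p) Y Z hY hZ

lemma nabla_extend (nabla : AffineConnection n M) (w : TangentSpace (𝓡 n) p) :
    nabla (FiberBundle.extend (Rn n) w) p = nabla (frame p w) p :=
  nabla.isCovariantDerivativeOnUniv.congr_of_eventuallyEq
    (FiberBundle.mdifferentiableAt_extend (𝓡 n) (Rn n) w)
    (differentiableFieldAt_frame (mem_chart_source (Rn n) p) w) Filter.univ_mem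
    (extend_eventuallyEq_frame w)

/-- A symmetric bilinear operation is determined by Koszul's formula. -/
lemma koszul {V : Type*} [AddCommGroup V] [Module ℝ V] (B : V → V → ℝ) (D : V → V → V)
    (K : V → V → V → ℝ) (hB : ∀ u v, B u v = B v u) (hD : ∀ u v, D u v = D v u)
    (hK : ∀ u v w, K u v w = B (D u v) w + B v (D u w)) (u v w : V) :
    B (D u v) w = (1 / 2) * (K u v w + K v u w - K w u v) := by
  rw [hK u v w, hK v u w, hK w u v, hB v (D u w), hB u (D v w), hB u (D w v), hD v u, hD w u,
    hD w v]
  ring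

lemma inner_eq_of_forall (h : RMetric n M) {v w : TangentSpace (𝓡 n) p}
    (hvw : ∀ z, h.inner p v z = h.inner p w z) : v = w := by
  by_contra hne
  have := h.pos p (v - w) (sub_ne_zero.2 hne)
  rw [map_sub] at this
  simp [hvw] at this

/-! ### Connections given by coefficients -/

/-- `contract` as a bilinear map. -/
def contractL (Γ : Fin n → Fin n → Fin n → ℝ) : Rn n →ₗ[ℝ] Rn n →ₗ[ℝ] Rn n :=
  LinearMap.mk₂ ℝ (NatCoord.contract Γ)
    (fun v w z ↦ by
      ext i; simp [NatCoord.contract, mul_add, add_mul, Finset.sum_add_distrib])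
    (fun c v z ↦ by
      ext i; simp only [NatCoord.contract, PiLp.smul_apply, smul_eq_mul, Finset.mul_sum]
      exact Finset.sum_congr rfl fun _ _ ↦ Finset.sum_congr rfl fun _ _ ↦ by ring)
    (fun v w z ↦ by
      ext i; simp [NatCoord.contract, mul_add, Finset.sum_add_distrib])
    (fun c v z ↦ by
      ext i; simp only [NatCoord.contract, PiLp.smul_apply, smul_eq_mul, Finset.mul_sum]
      exact Finset.sum_congr rfl fun _ _ ↦ Finset.sum_congr rfl fun _ _ ↦ by ring)

/-- `contract Γ v` as a continuous linear map. -/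
def contractCLM (Γ : Fin n → Fin n → Fin n → ℝ) (v : Rn n) : Rn n →L[ℝ] Rn n :=
  LinearMap.toContinuousLinearMap (contractL Γ v)

lemma contract_comm {Γ : Fin n → Fin n → Fin n → ℝ} (hΓ : ∀ i j k, Γ i j k = Γ i k j)
    (v w : Rn n) : NatCoord.contract Γ v w = NatCoord.contract Γ w v := by
  ext i
  simp only [NatCoord.contract]
  rw [Finset.sum_comm]
  exact Finset.sum_congr rfl fun j _ ↦ Finset.sum_congr rfl fun k _ ↦ by rw [hΓ]; ring

/-- The connection with coefficients `Γ x` in the preferred chart at `x`. -/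
def connectionOfCoeff (Γ : M → Fin n → Fin n → Fin n → ℝ) : AffineConnection n M where
  toFun Y x := show TangentSpace (𝓡 n) x →L[ℝ] Rn n from
    mvfderiv (𝓡 n) (fun p ↦ comps x ⟨p, Y p⟩) x
      + (show TangentSpace (𝓡 n) x →L[ℝ] Rn n from
          contractCLM (Γ x) (Y x))
  -- Both axioms are checked one point at a time, each in the preferred chart of that point, so no
  -- transformation rule between the coefficients at different points is needed.
  isCovariantDerivativeOnUniv := by
    constructor
    · intro σ τ x hσ hτ _
      have hx := mem_chart_source (Rn n) x
      have hσ' := (differentiableFieldAt_iff hx σ).1 hσ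
      have hτ' := (differentiableFieldAt_iff hx τ).1 hτ
      have e : (fun q ↦ comps x ⟨q, (σ + τ) q⟩) =ᶠ[nhds x]
          (fun q ↦ comps x ⟨q, σ q⟩) + fun q ↦ comps x ⟨q, τ q⟩ := by
        filter_upwards [(chartAt (Rn n) x).open_source.mem_nhds hx] with q hq
        exact comps_add hq _ _
      have e2 : mvfderiv (𝓡 n) (fun q ↦ comps x ⟨q, (σ + τ) q⟩) x
          = mvfderiv (𝓡 n) ((fun q ↦ comps x ⟨q, σ q⟩) + fun q ↦ comps x ⟨q, τ q⟩) x := by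
        rw [mvfderiv, mvfderiv, e.mfderiv_eq]
        rfl
      ext X : 1
      change mvfderiv (𝓡 n) (fun q ↦ comps x ⟨q, (σ + τ) q⟩) x X
        + contractL (Γ x) ((show Rn n from σ x) + (show Rn n from τ x)) X
        = (mvfderiv (𝓡 n) (fun q ↦ comps x ⟨q, σ q⟩) x X + contractL (Γ x) (σ x) X)
          + (mvfderiv (𝓡 n) (fun q ↦ comps x ⟨q, τ q⟩) x X + contractL (Γ x) (τ x) X)
      have k (a b c : Rn n) : contractL (Γ x) (a + b) c
          = contractL (Γ x) a c + contractL (Γ x) b c := by rw [map_add]; rfl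
      exact (congrArg₂ (· + ·) (DFunLike.congr_fun (e2.trans (mvfderiv_add hσ' hτ')) X)
        (k (σ x) (τ x) X)).trans (add_add_add_comm _ _ _ _)
    · intro σ f x hσ hf _
      have hx := mem_chart_source (Rn n) x
      have hσ' := (differentiableFieldAt_iff hx σ).1 hσ
      have e : (fun q ↦ comps x ⟨q, (f • σ) q⟩) =ᶠ[nhds x] f • fun q ↦ comps x ⟨q, σ q⟩ := by
        filter_upwards [(chartAt (Rn n) x).open_source.mem_nhds hx] with q hq
        exact comps_smul hq _ _
      have e2 : mvfderiv (𝓡 n) (fun q ↦ comps x ⟨q, (f • σ) q⟩) x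
          = mvfderiv (𝓡 n) (f • fun q ↦ comps x ⟨q, σ q⟩) x := by
        rw [mvfderiv, mvfderiv, e.mfderiv_eq]
        rfl
      ext X : 1
      change mvfderiv (𝓡 n) (fun q ↦ comps x ⟨q, (f • σ) q⟩) x X
        + contractL (Γ x) (f x • (show Rn n from σ x)) X
        = f x • (mvfderiv (𝓡 n) (fun q ↦ comps x ⟨q, σ q⟩) x X + contractL (Γ x) (σ x) X)
          + (mvfderiv (𝓡 n) f x X) • (show Rn n from σ x)
      have k (c : ℝ) (a b : Rn n) : contractL (Γ x) (c • a) b = c • contractL (Γ x) a b := by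
        rw [map_smul]; rfl
      have k2 (c d : ℝ) (a b a' b' : Rn n) (h : b = b') :
          c • a + d • b + c • a' = c • (a + a') + d • b' := by rw [h]; module
      exact (congrArg₂ (· + ·) (DFunLike.congr_fun (e2.trans (mvfderiv_smul hf hσ')) X)
        (k (f x) (σ x) X)).trans (k2 _ _ _ _ _ _ (comps_self x (σ x)))

lemma connectionOfCoeff_apply (Γ : M → Fin n → Fin n → Fin n → ℝ)
    (Y : Π p : M, TangentSpace (𝓡 n) p) (x : M) (X : TangentSpace (𝓡 n) x) :
    connectionOfCoeff Γ Y x X = natDeriv x (Γ x) X Y := rfl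

end Connections

/-! ### Comparison of the Levi-Civita, Chern, Berwald and averaged connections -/

section Berwald

variable {n : ℕ} {M : Type*} [TopologicalSpace M] [ChartedSpace (Rn n) M]
  [IsManifold (𝓡 n) ∞ M]

/-- The coefficients at `x` of the Chern connection of a Berwald structure. -/
def chernCoeff (F : TangentBundle (𝓡 n) M → ℝ) (x : M) : Fin n → Fin n → Fin n → ℝ :=
  NatCoord.chern (localF F x) (chartAt (Rn n) x x) (WithLp.toLp 2 fun _ ↦ 1)

/-- The vector `(1, …, 1)` is the reference direction in `chernCoeff`; it is nonzero as soon as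
there is an index, that is, for `n > 0`. -/
lemma toLp_one_ne_zero (i : Fin n) : (WithLp.toLp 2 fun _ ↦ 1 : Rn n) ≠ 0 := fun h ↦ by
  have : (WithLp.toLp 2 fun _ ↦ 1 : Rn n) i = 0 := by rw [h]; rfl
  simp at this

variable {F : TangentBundle (𝓡 n) M → ℝ} {x p : M}

lemma exists_index {u : Rn n} (hu : u ≠ 0) : Nonempty (Fin n) := by
  by_contra h
  rw [not_nonempty_iff] at h
  exact hu (Subsingleton.elim _ _)

lemma chern_eq_chernCoeff (hF : IsBerwald F) (x : M) {u : Rn n} (hu : u ≠ 0) :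
    NatCoord.chern (localF F x) (chartAt (Rn n) x x) u = chernCoeff F x :=
  hF.chern_eq _ (IsManifold.chart_mem_maximalAtlas x) _ (mem_chart_target (Rn n) x) _ _ hu
    (toLp_one_ne_zero (exists_index hu).some)

lemma berwald_eq_chernCoeff (hF : IsBerwald F) (x : M) {u : Rn n} (hu : u ≠ 0) :
    NatCoord.berwald (localF F x) (chartAt (Rn n) x x) u = chernCoeff F x := by
  rw [(isLocalFinsler_localF hF.toIsFinsler x).berwald_eq_chern (mem_chart_target (Rn n) x)
    (hF.chern_eq _ (IsManifold.chart_mem_maximalAtlas x) _ (mem_chart_target (Rn n) x)) hu,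
    chern_eq_chernCoeff hF x hu]

lemma chernCoeff_symm (hF : IsFinsler F) (x : M) (i j k : Fin n) :
    chernCoeff F x i j k = chernCoeff F x i k j :=
  (isLocalFinsler_localF hF x).chern_symm (mem_chart_target (Rn n) x) (toLp_one_ne_zero i) i j k

lemma berwaldDeriv_eq (hF : IsBerwald F) (x : M) {u : Rn n} (hu : u ≠ 0)
    (X : TangentSpace (𝓡 n) x) (Y : Π p : M, TangentSpace (𝓡 n) p) :
    berwaldDeriv F x u X Y = natDeriv x (chernCoeff F x) X Y := by
  rw [berwaldDeriv, berwald_eq_chernCoeff hF x hu]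

lemma chernDeriv_eq (hF : IsBerwald F) (x : M) {u : Rn n} (hu : u ≠ 0)
    (X : TangentSpace (𝓡 n) x) (Y : Π p : M, TangentSpace (𝓡 n) p) :
    chernDeriv F x u X Y = natDeriv x (chernCoeff F x) X Y := by
  rw [chernDeriv, chern_eq_chernCoeff hF x hu]

lemma natDeriv_extend (Γ : Fin n → Fin n → Fin n → ℝ) (X v : TangentSpace (𝓡 n) x) :
    natDeriv x Γ X (FiberBundle.extend (Rn n) v) = NatCoord.contract Γ v X := by
  have e : (fun q ↦ comps x ⟨q, FiberBundle.extend (Rn n) v q⟩) =ᶠ[nhds x]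
      fun q ↦ comps x ⟨q, frame x v q⟩ := by
    filter_upwards [extend_eventuallyEq_frame v] with q hq
    rw [hq]
  have e2 : mvfderiv (𝓡 n) (fun q ↦ comps x ⟨q, FiberBundle.extend (Rn n) v q⟩) x
      = mvfderiv (𝓡 n) (fun q ↦ comps x ⟨q, frame x v q⟩) x := by
    rw [mvfderiv, mvfderiv, e.mfderiv_eq]
    rfl
  rw [natDeriv, e2.trans (mvfderiv_comps_frame (mem_chart_source (Rn n) x) v),
    FiberBundle.extend_apply_self]
  exact zero_add _

lemma mvfderiv_inner_eq (hF : IsBerwald F) {h : RMetric n M} (hpar : BerwaldParallel F h)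
    (X : TangentSpace (𝓡 n) x) {Y Z : Π p : M, TangentSpace (𝓡 n) p}
    (hY : DifferentiableFieldAt Y x) (hZ : DifferentiableFieldAt Z x) :
    mvfderiv (𝓡 n) (fun p ↦ h.inner p (Y p) (Z p)) x X
      = h.inner x (natDeriv x (chernCoeff F x) X Y) (Z x)
        + h.inner x (Y x) (natDeriv x (chernCoeff F x) X Z) := by
  -- For `n = 0` there is no nonzero direction at which to use `hpar`, but all vectors vanish.
  rcases isEmpty_or_nonempty (Fin n) with hn | ⟨⟨i⟩⟩
  · have h0 (v : TangentSpace (𝓡 n) x) : v = 0 := Subsingleton.elim (α := Rn n) _ _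
    rw [h0 X, h0 (Y x), h0 (Z x)]
    simp
    rfl
  · have := hpar x _ (toLp_one_ne_zero i) X Y Z hY hZ
    rwa [berwaldDeriv_eq hF x (toLp_one_ne_zero i),
      berwaldDeriv_eq hF x (toLp_one_ne_zero i)] at this

lemma isLeviCivita_connectionOfCoeff (hF : IsBerwald F) {h : RMetric n M}
    (hpar : BerwaldParallel F h) : IsLeviCivita h (connectionOfCoeff (chernCoeff F)) := by
  rw [isLeviCivita_iff]
  refine ⟨fun p u v ↦ ?_, fun p X Y Z hY hZ ↦ ?_⟩
  · rw [connectionOfCoeff_apply, connectionOfCoeff_apply, natDeriv_extend, natDeriv_extend]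
    exact contract_comm (chernCoeff_symm hF.toIsFinsler p) _ _
  · rw [connectionOfCoeff_apply, connectionOfCoeff_apply]
    exact mvfderiv_inner_eq hF hpar X hY hZ

/-- Uniqueness of the Levi-Civita connection: `nabla` and the connection with coefficients
`chernCoeff F` satisfy Koszul's formula with the same right-hand side, and `h` is nondegenerate. -/
lemma nabla_extend_eq_contract (hF : IsBerwald F) {h : RMetric n M} (hpar : BerwaldParallel F h)
    {nabla : AffineConnection n M} (hn : IsLeviCivita h nabla) (u v : TangentSpace (𝓡 n) x) :
    nabla (FiberBundle.extend (Rn n) v) x u = NatCoord.contract (chernCoeff F x) v u := by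
  obtain ⟨h1, h2⟩ := (isLeviCivita_iff h nabla).1 hn
  obtain ⟨h1', h2'⟩ := (isLeviCivita_iff h _).1 (isLeviCivita_connectionOfCoeff hF hpar)
  have hd (v : TangentSpace (𝓡 n) x) : DifferentiableFieldAt (FiberBundle.extend (Rn n) v) x :=
    FiberBundle.mdifferentiableAt_extend (𝓡 n) (Rn n) v
  have key := koszul (fun a b ↦ h.inner x a b) (fun a b ↦ nabla (FiberBundle.extend (Rn n) b) x a)
    (fun a b c ↦ mvfderiv (𝓡 n) (fun p ↦ h.inner p (FiberBundle.extend (Rn n) b p)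
      (FiberBundle.extend (Rn n) c p)) x a) (h.symm x) (h1 x)
    (fun a b c ↦ by simpa only [FiberBundle.extend_apply_self] using h2 x a _ _ (hd b) (hd c))
  have key' := koszul (fun a b ↦ h.inner x a b) (fun a b ↦
    connectionOfCoeff (chernCoeff F) (FiberBundle.extend (Rn n) b) x a)
    (fun a b c ↦ mvfderiv (𝓡 n) (fun p ↦ h.inner p (FiberBundle.extend (Rn n) b p)
      (FiberBundle.extend (Rn n) c p)) x a) (h.symm x) (h1' x)
    (fun a b c ↦ by simpa only [FiberBundle.extend_apply_self] using h2' x a _ _ (hd b) (hd c))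
  rw [← natDeriv_extend, ← connectionOfCoeff_apply]
  exact inner_eq_of_forall h fun z ↦ (key u v z).trans (key' u v z).symm

/-- The Levi-Civita connection of `h` has the coefficients of the Chern connection of `F`. -/
lemma nabla_eq_natDeriv (hF : IsBerwald F) {h : RMetric n M} (hpar : BerwaldParallel F h)
    {nabla : AffineConnection n M} (hn : IsLeviCivita h nabla) (X : TangentSpace (𝓡 n) x)
    {Y : Π p : M, TangentSpace (𝓡 n) p} (hY : DifferentiableFieldAt Y x) :
    nabla Y x X = natDeriv x (chernCoeff F x) X Y := by
  -- Splitting off the coordinate derivative reduces the claim to fields with constant components.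
  have h1 := comps_nabla nabla (mem_chart_source (Rn n) x) hY X
  rw [comps_self, comps_self] at h1
  refine (h1.trans ?_)
  rw [natDeriv]
  congr 1
  have h2 := nabla_extend_eq_contract hF hpar hn X (Y x)
  rw [nabla_extend] at h2
  refine Eq.trans (congrArg (fun w ↦ nabla (frame x w) x X) (comps_self x (Y x))) h2

/-! ### The volume of the indicatrix -/

lemma localF_self (F : TangentBundle (𝓡 n) M → ℝ) (x : M) (v : TangentSpace (𝓡 n) x) :
    localF F x (chartAt (Rn n) x x) v = F ⟨x, v⟩ := by
  refine (localF_apply F (mem_chart_source (Rn n) x) v).trans ?_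
  exact congrArg (fun w ↦ F ⟨x, w⟩) (frame_self x v)

namespace NatCoord.IsLocalFinsler

variable {U : Set (Rn n)} {φ : Rn n → Rn n → ℝ} (H : IsLocalFinsler U φ) {z : Rn n}

include H in
lemma continuousOn (hz : z ∈ U) : ContinuousOn (φ z) {0}ᶜ := fun _ hy ↦
  (H.smooth.differentiableAt_right H.isOpen hz hy).continuousAt.continuousWithinAt

include H in
lemma continuousOn_det (hz : z ∈ U) : ContinuousOn (fun y ↦ (fund φ z y).det) {0}ᶜ := by
  intro y hy
  have : ContinuousAt (fund φ z) y := continuousAt_pi.2 fun i ↦ continuousAt_pi.2 fun j ↦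
    ((H.smooth_fund i j).differentiableAt_right H.isOpen hz hy).continuousAt
  exact ((continuous_id.matrix_det).continuousAt.comp this).continuousWithinAt

include H in
lemma measurable (hz : z ∈ U) : Measurable (φ z) :=
  measurable_of_continuousOn_compl_singleton 0 (H.continuousOn hz)

lemma sphere_subset : Metric.sphere (0 : Rn n) 1 ⊆ {0}ᶜ := fun y hy h0 ↦ by
  rw [mem_singleton_iff.1 h0] at hy
  simp at hy

lemma smul_mem_sphere {y : Rn n} (hy : y ≠ 0) : ‖y‖⁻¹ • y ∈ Metric.sphere (0 : Rn n) 1 := by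
  simp [norm_smul, hy]

include H in
-- Compactness of the Euclidean unit sphere gives the bounds there; homogeneity of degree `1` for
-- `φ` and `0` for `g` extends them to all nonzero `y`.
lemma exists_bounds [Nonempty (Fin n)] (hz : z ∈ U) :
    ∃ m : ℝ, 0 < m ∧ ∀ y, y ≠ 0 → m * ‖y‖ ≤ φ z y ∧ m ≤ (fund φ z y).det ∧
      (fund φ z y).det ≤ m⁻¹ := by
  have hc := isCompact_sphere (0 : Rn n) 1
  have hne : (Metric.sphere (0 : Rn n) 1).Nonempty := NormedSpace.sphere_nonempty.2 zero_le_one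
  obtain ⟨y1, hy1, h1⟩ := hc.exists_isMinOn hne ((H.continuousOn hz).mono sphere_subset)
  obtain ⟨y2, hy2, h2⟩ := hc.exists_isMinOn hne ((H.continuousOn_det hz).mono sphere_subset)
  obtain ⟨y3, hy3, h3⟩ := hc.exists_isMaxOn hne ((H.continuousOn_det hz).mono sphere_subset)
  have p1 := H.pos hz (sphere_subset hy1)
  have p2 := (H.posDef z hz _ (sphere_subset hy2)).det_pos
  have p3 := (H.posDef z hz _ (sphere_subset hy3)).det_pos
  -- One constant serves all three bounds: the minimum of `φ`, the minimum of `det g`, and the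
  -- inverse of the maximum of `det g`.
  refine ⟨min (φ z y1) (min (fund φ z y2).det ((fund φ z y3).det)⁻¹), by positivity,
    fun y hy ↦ ?_⟩
  have hs := smul_mem_sphere hy
  have hn : 0 < ‖y‖ := norm_pos_iff.2 hy
  have e : fund φ z (‖y‖⁻¹ • y) = fund φ z y := H.fund_hom hz hy (by positivity)
  have b1 := h1 hs
  have b2 := h2 hs
  have b3 := h3 hs
  simp only [mem_ofPred_eq, e] at b1 b2 b3
  rw [H.hom z hz y _ (by positivity)] at b1
  refine ⟨?_, (min_le_right _ _).trans ((min_le_left _ _).trans b2), b3.trans ?_⟩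
  · calc _ ≤ φ z y1 * ‖y‖ := by gcongr; exact min_le_left _ _
      _ ≤ (‖y‖⁻¹ * φ z y) * ‖y‖ := by gcongr
      _ = φ z y := by field_simp
  · rw [le_inv_comm₀ p3 (by positivity)]
    exact (min_le_right _ _).trans (min_le_right _ _)

/-- The Riemannian volume of the punctured unit ball of `φ`. -/
lemma volume_unitBall [Nonempty (Fin n)] (H : IsLocalFinsler U φ) (hz : z ∈ U) :
    ((volume : Measure (Rn n)).withDensity fun y ↦ ENNReal.ofReal (√(fund φ z y).det))
        {y : Rn n | y ≠ 0 ∧ φ z y < 1} ≠ 0 ∧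
    ((volume : Measure (Rn n)).withDensity fun y ↦ ENNReal.ofReal (√(fund φ z y).det))
        {y : Rn n | y ≠ 0 ∧ φ z y < 1} ≠ ⊤ := by
  obtain ⟨m, hm, hb⟩ := H.exists_bounds hz
  set S := {y : Rn n | y ≠ 0 ∧ φ z y < 1} with hS
  have hop : IsOpen S := (H.continuousOn hz).isOpen_inter_preimage isOpen_compl_singleton isOpen_Iio
  have hne : S.Nonempty := by
    obtain ⟨y, hy⟩ := exists_ne (0 : Rn n)
    have hp := H.pos hz hy
    -- This rescaled vector has `φ = 1/2`.
    refine ⟨(2 * φ z y)⁻¹ • y, smul_ne_zero (by positivity) hy, ?_⟩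
    rw [H.hom z hz y _ (by positivity), mul_inv, mul_assoc, inv_mul_cancel₀ hp.ne']
    norm_num
  have hfin : volume S ≠ ⊤ := by
    have hsub : S ⊆ Metric.closedBall 0 m⁻¹ := fun y hy ↦ by
      have := (hb y hy.1).1
      rw [mem_closedBall_zero_iff, ← one_div, le_div_iff₀ hm, mul_comm]
      exact this.trans hy.2.le
    exact ((measure_mono hsub).trans_lt measure_closedBall_lt_top).ne
  rw [withDensity_apply _ hop.measurableSet]
  constructor
  · have hle : ∫⁻ _ in S, ENNReal.ofReal √m ≤ ∫⁻ y in S, ENNReal.ofReal √(fund φ z y).det :=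
      setLIntegral_mono' hop.measurableSet fun y hy ↦
        ENNReal.ofReal_le_ofReal (Real.sqrt_le_sqrt (hb y hy.1).2.1)
    rw [setLIntegral_const] at hle
    refine fun h0 ↦ ?_
    rw [h0, nonpos_iff_eq_zero, mul_eq_zero] at hle
    rcases hle with hle | hle
    · rw [ENNReal.ofReal_eq_zero] at hle
      exact absurd (Real.sqrt_pos.2 hm) (not_lt.2 hle)
    · exact (hop.measure_pos volume hne).ne' hle
  · have hle : ∫⁻ y in S, ENNReal.ofReal √(fund φ z y).det ≤ ∫⁻ _ in S, ENNReal.ofReal √m⁻¹ :=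
      setLIntegral_mono' hop.measurableSet fun y hy ↦
        ENNReal.ofReal_le_ofReal (Real.sqrt_le_sqrt (hb y hy.1).2.2)
    rw [setLIntegral_const] at hle
    exact (hle.trans_lt (ENNReal.mul_lt_top ENNReal.ofReal_lt_top hfin.lt_top)).ne

end NatCoord.IsLocalFinsler

/-- The average over the indicatrix of a function which is constant on `T_xM ∖ {0}`. -/
lemma average_indicatrixVolume [Nonempty (Fin n)] (hF : IsFinsler F) (x : M) {f : Rn n → Rn n}
    {c : Rn n} (hf : ∀ u, u ≠ 0 → f u = c) : ⨍ u, f u ∂(indicatrixVolume F x) = c := by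
  have H := isLocalFinsler_localF hF x
  have hx := mem_chart_target (Rn n) x
  have e : (fun y : Rn n ↦ F ⟨x, y⟩) = localF F x (chartAt (Rn n) x x) :=
    funext fun y ↦ (localF_self F x y).symm
  have hm : Measurable fun y : Rn n ↦ F ⟨x, y⟩ := e ▸ H.measurable hx
  have hT : Measurable fun y : Rn n ↦ (F ⟨x, y⟩)⁻¹ • y := hm.inv.smul measurable_id
  have hv := H.volume_unitBall hx
  simp only [show ∀ y, localF F x (chartAt (Rn n) x x) y = F ⟨x, y⟩ from localF_self F x] at hv
  have huniv : indicatrixVolume F x univ = n * ((volume : Measure (Rn n)).withDensity fun y ↦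
      ENNReal.ofReal (√(NatCoord.fund (localF F x) (chartAt (Rn n) x x) y).det))
        {y : Rn n | y ≠ 0 ∧ F ⟨x, y⟩ < 1} := by
    rw [indicatrixVolume, Measure.smul_apply, Measure.map_apply hT MeasurableSet.univ,
      preimage_univ,
      Measure.restrict_apply_univ, smul_eq_mul]
  have hn : (n : ENNReal) ≠ 0 := by
    have : NeZero n := Fin.pos_iff_nonempty.2 ‹_› |>.ne' |> NeZero.mk
    exact NeZero.ne _
  -- The average of a constant is that constant only for a finite nonzero measure.
  have : IsFiniteMeasure (indicatrixVolume F x) := ⟨by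
    rw [huniv]; exact ENNReal.mul_lt_top (ENNReal.natCast_lt_top n) hv.2.lt_top⟩
  have : NeZero (indicatrixVolume F x) := ⟨fun h0 ↦ by
    rw [h0] at huniv
    exact mul_ne_zero hn hv.1 huniv.symm⟩
  have hS : MeasurableSet {y : Rn n | y ≠ 0 ∧ F ⟨x, y⟩ < 1} :=
    (measurableSet_singleton 0).compl.inter (hm measurableSet_Iio)
  -- The function equals `c` only off the origin; the radial projection of a nonzero vector is
  -- nonzero, so the origin is negligible.
  have hae : ∀ᵐ u ∂(indicatrixVolume F x), u ≠ 0 := by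
    rw [indicatrixVolume]
    refine Measure.ae_smul_measure ((ae_map_iff hT.aemeasurable (p := fun u : Rn n ↦ u ≠ 0)
      (measurableSet_singleton 0).compl).2 ?_) _
    filter_upwards [ae_restrict_mem hS] with y hy
    refine smul_ne_zero (inv_ne_zero ?_) hy.1
    rw [← localF_self F x y]
    exact (H.pos hx hy.1).ne'
  rw [average_congr (hae.mono hf), average_const]

lemma averagedBerwald_eq (hF : IsBerwald F) (x : M) (X : TangentSpace (𝓡 n) x)
    (Y : Π p : M, TangentSpace (𝓡 n) p) :
    averagedBerwald F x X Y = natDeriv x (chernCoeff F x) X Y := by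
  rcases isEmpty_or_nonempty (Fin n) with hn | hn
  · exact Subsingleton.elim _ _
  · exact average_indicatrixVolume hF.toIsFinsler x fun u hu ↦ berwaldDeriv_eq hF x hu X Y

end Berwald

/-! ### The metric and its Christoffel symbols in a fixed chart -/

section
set_option maxSynthPendingDepth 3

/-- Koszul's formula for the Christoffel symbols of the first kind, from the derivative `D` of the
metric. -/
def koszulForm {V : Type*} [NormedAddCommGroup V] [NormedSpace ℝ V]
    (D : V →L[ℝ] V →L[ℝ] V →L[ℝ] ℝ) (u : V) : V →L[ℝ] V →L[ℝ] ℝ :=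
  (1 / 2 : ℝ) • (D u + D.flip u - (D.flip u).flip)

lemma koszulForm_apply {V : Type*} [NormedAddCommGroup V] [NormedSpace ℝ V]
    (D : V →L[ℝ] V →L[ℝ] V →L[ℝ] ℝ) (u v w : V) :
    koszulForm D u v w = (1 / 2) * (D u v w + D v u w - D w u v) := rfl

lemma continuous_koszulForm {V : Type*} [NormedAddCommGroup V] [NormedSpace ℝ V] :
    Continuous fun q : (V →L[ℝ] V →L[ℝ] V →L[ℝ] ℝ) × V ↦ koszulForm q.1 q.2 := by
  unfold koszulForm
  have hf : Continuous fun q : (V →L[ℝ] V →L[ℝ] V →L[ℝ] ℝ) × V ↦ q.1.flip q.2 :=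
    ((ContinuousLinearMap.flipₗᵢ ℝ V V (V →L[ℝ] ℝ)).continuous.comp
      continuous_fst).clm_apply continuous_snd
  exact (((continuous_fst.clm_apply continuous_snd).add hf).sub
    ((ContinuousLinearMap.flipₗᵢ ℝ V V ℝ).continuous.comp hf)).const_smul (1 / 2 : ℝ)

section MetricInChart

variable {n : ℕ} {M : Type*} [TopologicalSpace M] [ChartedSpace (Rn n) M]
  [IsManifold (𝓡 n) ∞ M]

/-- The metric `h` in the preferred chart at `x`. -/
def metricInChart (h : RMetric n M) (x : M) (y : Rn n) : Rn n →L[ℝ] Rn n →L[ℝ] ℝ :=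
  LinearMap.toContinuousBilinearMap (LinearMap.mk₂ ℝ
    (fun v w ↦ h.inner ((chartAt (Rn n) x).symm y) (frame x v _) (frame x w _))
    (fun v w z ↦ by rw [frame_add, Pi.add_apply, map_add]; rfl)
    (fun c v z ↦ by rw [frame_smul, Pi.smul_apply, map_smul]; rfl)
    (fun v w z ↦ by rw [frame_add, Pi.add_apply, map_add])
    (fun c v z ↦ by rw [frame_smul, Pi.smul_apply, map_smul]))

variable (h : RMetric n M) {x p : M}

lemma metricInChart_apply (hp : p ∈ (chartAt (Rn n) x).source) (v w : Rn n) :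
    metricInChart h x (chartAt (Rn n) x p) v w = h.inner p (frame x v p) (frame x w p) := by
  change h.inner ((chartAt (Rn n) x).symm (chartAt (Rn n) x p)) (frame x v _) (frame x w _) = _
  rw [(chartAt (Rn n) x).left_inv hp]

lemma contMDiffAt_inner_frame (hp : p ∈ (chartAt (Rn n) x).source) (v w : Rn n) :
    ContMDiffAt (𝓡 n) 𝓘(ℝ, ℝ) ∞ (fun q ↦ h.inner q (frame x v q) (frame x w q)) p := by
  let _ : RiemannianBundle (fun x : M ↦ TangentSpace (𝓡 n) x) := ⟨h.toRiemannianMetric⟩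
  exact (contMDiffAt_frame hp v).inner_bundle (contMDiffAt_frame hp w)

lemma contDiffOn_metricInChart (x : M) :
    ContDiffOn ℝ ∞ (metricInChart h x) (chartAt (Rn n) x).target := by
  refine contDiffOn_clm_apply.2 fun v ↦ contDiffOn_clm_apply.2 fun w ↦ ?_
  have h1 : ContMDiffOn (𝓡 n) 𝓘(ℝ, ℝ) ∞ (fun q ↦ h.inner q (frame x v q) (frame x w q))
      (chartAt (Rn n) x).source := fun q hq ↦
    (contMDiffAt_inner_frame h hq v w).contMDiffWithinAt
  exact (h1.comp (contMDiffOn_chart_symm (x := x)) (chartAt (Rn n) x).symm.mapsTo).contDiffOn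

/-- Chain rule through the chart, whose differential sends the coordinate field of `u` to the
constant `u`. -/
lemma mvfderiv_inner_frame (hp : p ∈ (chartAt (Rn n) x).source) (u v w : Rn n) :
    mvfderiv (𝓡 n) (fun q ↦ h.inner q (frame x v q) (frame x w q)) p (frame x u p)
      = fderiv ℝ (metricInChart h x) (chartAt (Rn n) x p) u v w := by
  set e := chartAt (Rn n) x
  have hd : DifferentiableAt ℝ (metricInChart h x) (e p) :=
    ((contDiffOn_metricInChart h x).contDiffAt
      (e.open_target.mem_nhds (e.map_source hp))).differentiableAt (by simp)
  have hd2 : HasFDerivAt (fun y ↦ metricInChart h x y v w)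
      (((fderiv ℝ (metricInChart h x) (e p)).flip v).flip w) (e p) := by
    have := (hd.hasFDerivAt.clm_apply (hasFDerivAt_const v (e p))).clm_apply
      (hasFDerivAt_const w (e p))
    refine this.congr_fderiv ?_
    ext u
    simp
  have e1 : (fun q ↦ h.inner q (frame x v q) (frame x w q)) =ᶠ[nhds p]
      (fun y ↦ metricInChart h x y v w) ∘ e := by
    filter_upwards [e.open_source.mem_nhds hp] with q hq
    exact (metricInChart_apply h hq v w).symm
  have hm : HasMFDerivAt (𝓡 n) 𝓘(ℝ, Rn n) e p (mfderiv (𝓡 n) 𝓘(ℝ, Rn n) e p) :=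
    (mdifferentiableAt_atlas (chart_mem_atlas _ x) hp).hasMFDerivAt
  have hc := (hd2.hasMFDerivAt.comp p hm).congr_of_eventuallyEq e1
  have h3 : mfderiv (𝓡 n) 𝓘(ℝ, Rn n) e p (frame x u p) = u :=
    (comps_eq_mfderiv hp _).symm.trans (comps_frame hp u)
  rw [mvfderiv, hc.mfderiv]
  exact congrArg (fun z : Rn n ↦ fderiv ℝ (metricInChart h x) (e p) z v w) h3

/-- The Christoffel symbols of the Levi-Civita connection in the preferred chart at `x`, contracted
with `u`. -/
def christoffel (x : M) (y u : Rn n) : Rn n →L[ℝ] Rn n :=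
  (metricInChart h x y).inverse ∘L koszulForm (fderiv ℝ (metricInChart h x) y) u

/-- Positive definiteness makes the metric injective as a map to the dual, and the dimensions agree.
-/
lemma exists_metricInChart_equiv {y : Rn n} (hy : y ∈ (chartAt (Rn n) x).target) :
    ∃ E : Rn n ≃L[ℝ] (Rn n →L[ℝ] ℝ), (E : Rn n →L[ℝ] Rn n →L[ℝ] ℝ) = metricInChart h x y := by
  have hinj : Function.Injective (metricInChart h x y : Rn n →ₗ[ℝ] (Rn n →L[ℝ] ℝ)) := by
    rw [← LinearMap.ker_eq_bot, LinearMap.ker_eq_bot']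
    intro v hv
    by_contra hne
    have hq := (chartAt (Rn n) x).map_target hy
    have hf : frame x v ((chartAt (Rn n) x).symm y) ≠ 0 := fun h0 ↦ by
      apply hne
      have := comps_frame hq v
      rw [h0, comps_eq hq, map_zero] at this
      exact this.symm
    have hpos := h.pos _ _ hf
    have h0 : metricInChart h x y v v = 0 := by
      change (metricInChart h x y : Rn n →ₗ[ℝ] (Rn n →L[ℝ] ℝ)) v v = 0
      rw [hv]; rfl
    exact hpos.ne' h0
  have hrank : Module.finrank ℝ (Rn n) = Module.finrank ℝ (Rn n →L[ℝ] ℝ) :=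
    (Subspace.dual_finrank_eq (K := ℝ) (V := Rn n)).symm.trans
      (LinearMap.toContinuousLinearMap (𝕜 := ℝ) (E := Rn n) (F' := ℝ)).finrank_eq
  have hsurj := (LinearMap.injective_iff_surjective_of_finrank_eq_finrank hrank).1 hinj
  exact ⟨ContinuousLinearEquiv.ofBijective _ (LinearMap.ker_eq_bot.2 hinj)
    (LinearMap.range_eq_top.2 hsurj), ContinuousLinearEquiv.coe_ofBijective _ _ _⟩

/-- Koszul's formula for coordinate fields, with the last index raised by the inverse metric. It
expresses an arbitrary Levi-Civita connection through `h` and its first derivatives; this is the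
source of continuity of the coefficients along a curve. -/
lemma comps_nabla_frame {nabla : AffineConnection n M} (hn : IsLeviCivita h nabla)
    (hp : p ∈ (chartAt (Rn n) x).source) (u v : Rn n) :
    comps x ⟨p, nabla (frame x v) p (frame x u p)⟩
      = christoffel h x (chartAt (Rn n) x p) u v := by
  obtain ⟨E, hE⟩ := exists_metricInChart_equiv h ((chartAt (Rn n) x).map_source hp)
  have hd (v : Rn n) := differentiableFieldAt_frame hp v
  have hsymm (u v : Rn n) : nabla (frame x v) p (frame x u p)
      = nabla (frame x u) p (frame x v p) := by
    have : IsManifold (𝓡 n) 2 M := isManifold_two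
    have h1 := nabla.torsion_apply (hd u) (hd v)
    have h0 : nabla.torsion p (frame x u p) (frame x v p) = 0 := by rw [hn.1]; rfl
    rw [h0, mlieBracket_frame hp, sub_zero] at h1
    exact (sub_eq_zero.1 h1.symm)
  have hsymm' (a b : Rn n) : metricInChart h x (chartAt (Rn n) x p) a b
      = metricInChart h x (chartAt (Rn n) x p) b a := by
    rw [metricInChart_apply h hp, metricInChart_apply h hp, h.symm]
  have key := koszul (fun a b ↦ metricInChart h x (chartAt (Rn n) x p) a b)
    (fun a b ↦ comps x ⟨p, nabla (frame x b) p (frame x a p)⟩)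
    (fun a b c ↦ fderiv ℝ (metricInChart h x) (chartAt (Rn n) x p) a b c) hsymm'
    (fun a b ↦ by rw [hsymm]) (fun a b c ↦ by
      rw [← mvfderiv_inner_frame h hp, metricInChart_apply h hp, metricInChart_apply h hp,
        frame_comps hp, frame_comps hp]
      exact ((isLeviCivita_iff h nabla).1 hn).2 p _ _ _ (hd b) (hd c)) u v
  rw [christoffel, ← hE, ContinuousLinearMap.inverse_equiv]
  change _ = E.symm _
  rw [ContinuousLinearEquiv.eq_symm_apply]
  ext w : 1
  change (E : Rn n →L[ℝ] Rn n →L[ℝ] ℝ) _ w = _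
  rw [hE, key w]
  exact (koszulForm_apply _ u v w).symm

lemma continuousOn_inverse_metricInChart (x : M) :
    ContinuousOn (fun y ↦ (metricInChart h x y).inverse) (chartAt (Rn n) x).target := fun y hy ↦ by
  obtain ⟨E, hE⟩ := exists_metricInChart_equiv h hy
  have h1 : ContinuousAt ContinuousLinearMap.inverse (metricInChart h x y) :=
    hE ▸ (contDiffAt_map_inverse (𝕜 := ℝ) (n := 0) E).continuousAt
  exact h1.comp_continuousWithinAt ((contDiffOn_metricInChart h x).continuousOn y hy)

lemma continuousOn_fderiv_metricInChart (x : M) :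
    ContinuousOn (fderiv ℝ (metricInChart h x)) (chartAt (Rn n) x).target :=
  (contDiffOn_metricInChart h x).continuousOn_fderiv_of_isOpen (chartAt (Rn n) x).open_target
    (by simp)

lemma continuousOn_christoffel {s : Set ℝ} {y u : ℝ → Rn n} (hy : ContinuousOn y s)
    (hu : ContinuousOn u s) (hs : MapsTo y s (chartAt (Rn n) x).target) :
    ContinuousOn (fun t ↦ christoffel h x (y t) (u t)) s := by
  have h1 := (continuousOn_inverse_metricInChart h x).comp hy hs
  have h2 := (continuousOn_fderiv_metricInChart h x).comp hy hs
  have h3 := continuous_koszulForm.comp_continuousOn (h2.prodMk hu)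
  exact h1.clm_comp h3

end MetricInChart

end

/-! ### Linear differential equations on short intervals -/

section LinearODE

variable {E : Type*} [NormedAddCommGroup E] [NormedSpace ℝ E] {A : ℝ → E →L[ℝ] E} {a b K t₀ : ℝ}

/-- A linear differential equation on a short interval is solvable. -/
lemma exists_linearODE_solution [CompleteSpace E] (hA : ContinuousOn A (Icc a b))
    (hK : ∀ t ∈ Icc a b, ‖A t‖ ≤ K) (hab : K * (b - a) ≤ 1 / 2) (ht₀ : t₀ ∈ Icc a b) (v : E) :
    ∃ w : ℝ → E, w t₀ = v ∧ ∀ t ∈ Icc a b, HasDerivWithinAt w (A t (w t)) (Icc a b) t := by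
  have hK0 : 0 ≤ K := (norm_nonneg _).trans (hK t₀ ht₀)
  -- On the ball of radius `‖v‖` about `v` one has `‖w‖ ≤ 2 ‖v‖`, so the speed is at most `2 K ‖v‖`.
  -- The length condition `K (b - a) ≤ 1/2` keeps solutions inside this ball.
  have hP : IsPicardLindelof (fun t w ↦ A t w) (⟨t₀, ht₀⟩ : Icc a b) v ‖v‖₊ 0
      (⟨K, hK0⟩ * (2 * ‖v‖₊)) ⟨K, hK0⟩ := by
    constructor
    · intro t ht
      exact ((A t).lipschitz.weaken (hK t ht)).lipschitzOnWith
    · exact fun w _ ↦ hA.clm_apply continuousOn_const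
    · intro t ht w hw
      have h1 : ‖w‖ ≤ 2 * ‖v‖ := by
        have h2 : ‖w - v‖ ≤ ‖v‖ := by
          simpa [dist_eq_norm] using hw
        linarith [norm_le_norm_add_norm_sub' w v]
      exact ((A t).le_opNorm w).trans (mul_le_mul (hK t ht) h1 (norm_nonneg _) hK0)
    · have h1 : max (b - t₀) (t₀ - a) ≤ b - a :=
        max_le (by linarith [ht₀.1]) (by linarith [ht₀.2])
      have h2 : K * max (b - t₀) (t₀ - a) ≤ 1 / 2 :=
        (mul_le_mul_of_nonneg_left h1 hK0).trans hab
      change K * (2 * ‖v‖) * max (b - t₀) (t₀ - a) ≤ ‖v‖ - 0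
      nlinarith [norm_nonneg v]
  exact hP.exists_eq_forall_mem_Icc_hasDerivWithinAt₀

/-- Solutions of a linear differential equation on a short interval are unique. -/
lemma eqOn_of_linearODE_solution (hK : ∀ t ∈ Icc a b, ‖A t‖ ≤ K) (hab : K * (b - a) ≤ 1 / 2)
    (ht₀ : t₀ ∈ Icc a b) {w₁ w₂ : ℝ → E}
    (h₁ : ∀ t ∈ Icc a b, HasDerivWithinAt w₁ (A t (w₁ t)) (Icc a b) t)
    (h₂ : ∀ t ∈ Icc a b, HasDerivWithinAt w₂ (A t (w₂ t)) (Icc a b) t) (h0 : w₁ t₀ = w₂ t₀) :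
    EqOn w₁ w₂ (Icc a b) := by
  have hK0 : 0 ≤ K := (norm_nonneg _).trans (hK t₀ ht₀)
  have hd : ∀ t ∈ Icc a b, HasDerivWithinAt (w₁ - w₂) (A t ((w₁ - w₂) t)) (Icc a b) t :=
    fun t ht ↦ by simpa using (h₁ t ht).sub (h₂ t ht)
  -- At the maximum of the norm of the difference, the mean value inequality from `t₀` bounds that
  -- maximum by half of itself.
  obtain ⟨m, hm, hmax⟩ := isCompact_Icc.exists_isMaxOn ⟨t₀, ht₀⟩
    (f := fun t ↦ ‖(w₁ - w₂) t‖) fun t ht ↦ (hd t ht).continuousWithinAt.norm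
  have hmax' : ∀ t ∈ Icc a b, ‖(w₁ - w₂) t‖ ≤ ‖(w₁ - w₂) m‖ := fun t ht ↦ hmax ht
  have h1 := (convex_Icc a b).norm_image_sub_le_of_norm_hasDerivWithin_le (f := w₁ - w₂)
    (C := K * ‖(w₁ - w₂) m‖) hd
    (fun t ht ↦ ((A t).le_opNorm _).trans
      (mul_le_mul (hK t ht) (hmax' t ht) (norm_nonneg _) hK0)) ht₀ hm
  have h2 : (w₁ - w₂) t₀ = 0 := by simp [h0]
  have h3 : ‖m - t₀‖ ≤ b - a := by
    rw [Real.norm_eq_abs, abs_le]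
    constructor <;> linarith [hm.1, hm.2, ht₀.1, ht₀.2]
  have h4 : ‖(w₁ - w₂) m‖ ≤ 0 := by
    rw [h2, sub_zero] at h1
    nlinarith [norm_nonneg ((w₁ - w₂) m), mul_le_mul_of_nonneg_left h3
      (mul_nonneg hK0 (norm_nonneg ((w₁ - w₂) m)))]
  intro t ht
  exact sub_eq_zero.1 (norm_le_zero_iff.1 ((hmax' t ht).trans h4))

end LinearODE

/-! ### The parallel equation along a curve and its independence of the chart -/

section Curves

variable {n : ℕ} {M : Type*} [TopologicalSpace M] [ChartedSpace (Rn n) M]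
  {c : ℝ → M} {t : ℝ} {s : Set ℝ}

lemma hasDerivWithinAt_comp_curve (hc : ContMDiffOn 𝓘(ℝ, ℝ) (𝓡 n) 1 c (Icc 0 1))
    (ht : t ∈ Icc (0 : ℝ) 1) (hs : s ⊆ Icc 0 1)
    {E : Type*} [NormedAddCommGroup E] [NormedSpace ℝ E] {f : M → E}
    (hf : MDifferentiableAt (𝓡 n) 𝓘(ℝ, E) f (c t)) :
    HasDerivWithinAt (f ∘ c) (mvfderiv (𝓡 n) f (c t) (velocity c t)) s t := by
  have h1 := ((hc t ht).mdifferentiableWithinAt one_ne_zero).hasMFDerivWithinAt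
  have h2 : HasFDerivWithinAt (f ∘ c) ((show Rn n →L[ℝ] E from mvfderiv (𝓡 n) f (c t)) ∘L
      (show ℝ →L[ℝ] Rn n from mfderivWithin 𝓘(ℝ, ℝ) (𝓡 n) c (Icc 0 1) t)) (Icc 0 1) t :=
    (hf.hasMFDerivAt.comp_hasMFDerivWithinAt t h1).hasFDerivWithinAt
  exact h2.hasDerivWithinAt.mono hs

lemma mvfderiv_clm_comp {E E' : Type*} [NormedAddCommGroup E] [NormedSpace ℝ E]
    [NormedAddCommGroup E'] [NormedSpace ℝ E'] (L : E →L[ℝ] E') {f : M → E} {p : M}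
    (hf : MDifferentiableAt (𝓡 n) 𝓘(ℝ, E) f p) (X : TangentSpace (𝓡 n) p) :
    mvfderiv (𝓡 n) (fun q ↦ L (f q)) p X = L (mvfderiv (𝓡 n) f p X) := by
  have h1 := (L.hasMFDerivAt (x := f p)).comp p hf.hasMFDerivAt
  exact DFunLike.congr_fun h1.mfderiv X

variable [IsManifold (𝓡 n) ∞ M] {x x₁ x₂ : M}

lemma hasDerivWithinAt_chart_curve (hc : ContMDiffOn 𝓘(ℝ, ℝ) (𝓡 n) 1 c (Icc 0 1))
    (ht : t ∈ Icc (0 : ℝ) 1) (hs : s ⊆ Icc 0 1) (hx : c t ∈ (chartAt (Rn n) x).source) :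
    HasDerivWithinAt (fun σ ↦ chartAt (Rn n) x (c σ)) (comps x ⟨c t, velocity c t⟩) s t := by
  rw [comps_eq_mfderiv hx]
  exact hasDerivWithinAt_comp_curve hc ht hs
    (mdifferentiableAt_atlas (chart_mem_atlas _ x) hx)

/-- The derivative of the coordinate change `A` along the curve is exactly the inhomogeneous term in
the transformation law of the connection coefficients. That law is `comps_nabla` applied in the
second chart to coordinate fields of the first. -/
lemma hasDerivWithinAt_comps_change (nabla : AffineConnection n M)
    (hc : ContMDiffOn 𝓘(ℝ, ℝ) (𝓡 n) 1 c (Icc 0 1)) (hs : s ⊆ Icc 0 1) (ht : t ∈ s)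
    (h₁ : c t ∈ (chartAt (Rn n) x₁).source) (h₂ : c t ∈ (chartAt (Rn n) x₂).source)
    {W : Π t : ℝ, TangentSpace (𝓡 n) (c t)}
    (hW : HasDerivWithinAt (fun σ ↦ comps x₁ ⟨c σ, W σ⟩)
      (-comps x₁ ⟨c t, nabla (frame x₁ (comps x₁ ⟨c t, W t⟩)) (c t) (velocity c t)⟩) s t) :
    HasDerivWithinAt (fun σ ↦ comps x₂ ⟨c σ, W σ⟩)
      (-comps x₂ ⟨c t, nabla (frame x₂ (comps x₂ ⟨c t, W t⟩)) (c t) (velocity c t)⟩) s t := by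
  set T₁ := trivializationAt (Rn n) (TangentSpace (𝓡 n) : M → Type _) x₁
  set T₂ := trivializationAt (Rn n) (TangentSpace (𝓡 n) : M → Type _) x₂
  set A : M → Rn n →L[ℝ] Rn n := fun p ↦ T₁.coordChangeL ℝ T₂ p
  have hA {p : M} (h₁ : p ∈ (chartAt (Rn n) x₁).source) (h₂ : p ∈ (chartAt (Rn n) x₂).source)
      (v : Rn n) : A p v = comps x₂ ⟨p, frame x₁ v p⟩ := by
    rw [frame_eq_symm h₁]
    exact Trivialization.coordChangeL_apply T₁ T₂ ⟨h₁, h₂⟩ v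
  have hO := ((chartAt (Rn n) x₁).open_source.inter (chartAt (Rn n) x₂).open_source).mem_nhds
    ⟨h₁, h₂⟩
  have hAd : MDifferentiableAt (𝓡 n) 𝓘(ℝ, Rn n →L[ℝ] Rn n) A (c t) :=
    ((contMDiffOn_coordChangeL (n := ∞) (IB := 𝓡 n) (e := T₁) (e' := T₂)).contMDiffAt
      hO).mdifferentiableAt (by simp)
  have hd := (hasDerivWithinAt_comp_curve hc (hs ht) hs hAd).clm_apply hW
  set v := comps x₁ ⟨c t, W t⟩ with hv
  have hWt : frame x₁ v (c t) = W t := frame_comps h₁ (W t)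
  have e1 : mvfderiv (𝓡 n) A (c t) (velocity c t) v
      = mvfderiv (𝓡 n) (fun q ↦ comps x₂ ⟨q, frame x₁ v q⟩) (c t) (velocity c t) := by
    refine (mvfderiv_clm_comp (ContinuousLinearMap.apply ℝ (Rn n) v) hAd _).symm.trans ?_
    have : (fun q ↦ ContinuousLinearMap.apply ℝ (Rn n) v (A q)) =ᶠ[nhds (c t)]
        fun q ↦ comps x₂ ⟨q, frame x₁ v q⟩ := by
      filter_upwards [hO] with q hq
      exact hA hq.1 hq.2 v
    exact DFunLike.congr_fun this.mfderiv_eq _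
  have key := comps_nabla nabla h₂ (differentiableFieldAt_frame h₁ v) (velocity c t)
  have e2 : comps x₂ ⟨c t, frame x₁ v (c t)⟩ = comps x₂ ⟨c t, W t⟩ :=
    congrArg (fun w ↦ comps x₂ ⟨c t, w⟩) hWt
  rw [e2, ← e1] at key
  have e3 : A (c t) (-comps x₁ ⟨c t, nabla (frame x₁ v) (c t) (velocity c t)⟩)
      = -comps x₂ ⟨c t, nabla (frame x₁ v) (c t) (velocity c t)⟩ := by
    rw [map_neg, hA h₁ h₂]
    exact congrArg (fun w ↦ -comps x₂ ⟨c t, w⟩) (frame_comps h₁ _)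
  have hd' := hd.congr_deriv (g' := -comps x₂ ⟨c t, nabla (frame x₂ (comps x₂ ⟨c t, W t⟩)) (c t)
      (velocity c t)⟩) (by
    change mvfderiv (𝓡 n) A (c t) (velocity c t) v + A (c t) _ = _
    rw [e3, key]
    abel)
  have hcont : ContinuousWithinAt c s t := (hc.continuousOn t (hs ht)).mono hs
  have ev : (fun σ ↦ comps x₂ ⟨c σ, W σ⟩) =ᶠ[nhdsWithin t s]
      fun σ ↦ (A ∘ c) σ (comps x₁ ⟨c σ, W σ⟩) := by
    filter_upwards [hcont hO] with σ hσ
    refine Eq.symm ((hA hσ.1 hσ.2 _).trans ?_)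
    exact congrArg (fun w ↦ comps x₂ ⟨c σ, w⟩) (frame_comps hσ.1 (W σ))
  exact hd'.congr_of_eventuallyEq_of_mem ev ht

/-- `W` is parallel along the restriction of `c` to `s`. -/
def IsParallelOn (nabla : AffineConnection n M) (c : ℝ → M) (s : Set ℝ)
    (W : Π t : ℝ, TangentSpace (𝓡 n) (c t)) : Prop :=
  ∀ t ∈ s, HasDerivWithinAt (fun σ ↦ comps (c t) ⟨c σ, W σ⟩)
    (-comps (c t) ⟨c t, nabla (frame (c t) (comps (c t) ⟨c t, W t⟩)) (c t) (velocity c t)⟩) s t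

lemma isParallelAlong_iff (nabla : AffineConnection n M) (W : Π t : ℝ, TangentSpace (𝓡 n) (c t)) :
    IsParallelAlong nabla c W ↔ IsParallelOn nabla c (Icc 0 1) W := by
  refine forall₂_congr fun t _ ↦ ?_
  rw [comps_self, comps_self]
  have := DFunLike.congr_fun (nabla_extend nabla (W t)) (velocity c t)
  exact iff_of_eq (congrArg (fun w : Rn n ↦ HasDerivWithinAt (fun σ ↦ comps (c t) ⟨c σ, W σ⟩)
    (-w) (Icc 0 1) t) this)

variable (h : RMetric n M) {nabla : AffineConnection n M}

/-- `IsParallelOn` uses a different chart at each time. On a piece of the curve inside one chart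
this turns it into a single linear equation in `ℝⁿ`. -/
lemma isParallelOn_iff (hn : IsLeviCivita h nabla)
    (hc : ContMDiffOn 𝓘(ℝ, ℝ) (𝓡 n) 1 c (Icc 0 1)) (hs : s ⊆ Icc 0 1)
    (hx : ∀ t ∈ s, c t ∈ (chartAt (Rn n) x).source) (W : Π t : ℝ, TangentSpace (𝓡 n) (c t)) :
    IsParallelOn nabla c s W ↔ ∀ t ∈ s, HasDerivWithinAt (fun σ ↦ comps x ⟨c σ, W σ⟩)
      ((-christoffel h x (chartAt (Rn n) x (c t)) (comps x ⟨c t, velocity c t⟩))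
        (comps x ⟨c t, W t⟩)) s t := by
  refine forall₂_congr fun t ht ↦ ?_
  have e : (-christoffel h x (chartAt (Rn n) x (c t)) (comps x ⟨c t, velocity c t⟩))
        (comps x ⟨c t, W t⟩)
      = -comps x ⟨c t, nabla (frame x (comps x ⟨c t, W t⟩)) (c t) (velocity c t)⟩ := by
    rw [neg_apply, ← comps_nabla_frame h hn (hx t ht)]
    exact congrArg (fun X ↦ -comps x ⟨c t, nabla (frame x (comps x ⟨c t, W t⟩)) (c t) X⟩)
      (frame_comps (hx t ht) _)
  rw [e]
  exact ⟨hasDerivWithinAt_comps_change nabla hc hs ht (mem_chart_source _ _) (hx t ht),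
    hasDerivWithinAt_comps_change nabla hc hs ht (hx t ht) (mem_chart_source _ _)⟩

lemma continuousOn_comps_velocity (hc : ContMDiffOn 𝓘(ℝ, ℝ) (𝓡 n) 1 c (Icc 0 1))
    (hs : s ⊆ Icc 0 1) (hx : ∀ t ∈ s, c t ∈ (chartAt (Rn n) x).source) :
    ContinuousOn (fun t ↦ comps (n := n) x ⟨c t, velocity c t⟩) s := by
  -- The set `s` need not have unique derivatives. Near `s`, the velocity is therefore computed
  -- within the relatively open part `Icc 0 1 ∩ O` of the interval that `c` maps into the chart.
  obtain ⟨O, hO, hO'⟩ := (continuousOn_iff'.1 hc.continuousOn) _ (chartAt (Rn n) x).open_source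
  have hu : UniqueDiffOn ℝ (Icc (0 : ℝ) 1 ∩ O) := (uniqueDiffOn_Icc one_pos).inter hO
  have hmem : ∀ t ∈ Icc (0 : ℝ) 1 ∩ O, c t ∈ (chartAt (Rn n) x).source := fun t ht ↦
    (hO'.symm ▸ (⟨ht.2, ht.1⟩ : t ∈ O ∩ Icc 0 1) : t ∈ c ⁻¹' _ ∩ Icc 0 1).1
  have hy : ContDiffOn ℝ 1 (fun t ↦ chartAt (Rn n) x (c t)) (Icc (0 : ℝ) 1 ∩ O) :=
    (((contMDiffOn_chart (I := 𝓡 n) (x := x) (n := ∞)).of_le (by norm_cast)).comp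
      (hc.mono inter_subset_left) hmem).contDiffOn
  refine ((hy.continuousOn_derivWithin hu le_rfl).congr fun t ht ↦ ?_).mono fun t ht ↦
    (⟨hs ht, (hO' ▸ (⟨hx t ht, hs ht⟩ : t ∈ c ⁻¹' _ ∩ Icc 0 1) : t ∈ O ∩ Icc 0 1).1⟩ :
      t ∈ Icc (0 : ℝ) 1 ∩ O)
  exact ((hasDerivWithinAt_chart_curve hc ht.1 inter_subset_left (hmem t ht)).derivWithin
    (hu t ht)).symm

end Curves

/-! ### Existence and uniqueness of parallel transport -/

section Transport

variable {n : ℕ} {M : Type*} [TopologicalSpace M] [ChartedSpace (Rn n) M]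
  [IsManifold (𝓡 n) ∞ M] {c : ℝ → M} {s s' : Set ℝ} {a b d : ℝ} {nabla : AffineConnection n M}
  {W W₁ W₂ : Π t : ℝ, TangentSpace (𝓡 n) (c t)}

lemma IsParallelOn.mono (hW : IsParallelOn nabla c s W) (hs : s' ⊆ s) : IsParallelOn nabla c s' W :=
  fun t ht ↦ (hW t (hs ht)).mono hs

lemma IsParallelOn.congr (hW : IsParallelOn nabla c s W₁) (h : ∀ t ∈ s, W₂ t = W₁ t) :
    IsParallelOn nabla c s W₂ := fun t ht ↦ by
  rw [h t ht]
  exact (hW t ht).congr (fun σ hσ ↦ by rw [h σ hσ]) (by rw [h t ht])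

/-- Away from `b` the equation is local; at `b` the derivatives within the two sides have the same
value and combine. -/
lemma IsParallelOn.glue (h₁ : IsParallelOn nabla c (Icc a b) W)
    (h₂ : IsParallelOn nabla c (Icc b d) W)
    (hab : a ≤ b) (hbd : b ≤ d) : IsParallelOn nabla c (Icc a d) W := fun t ht ↦ by
  rcases lt_trichotomy t b with h | rfl | h
  · refine (h₁ t ⟨ht.1, h.le⟩).mono_of_mem_nhdsWithin ?_
    filter_upwards [self_mem_nhdsWithin, mem_nhdsWithin_of_mem_nhds (Iio_mem_nhds h)] with σ h1 h2
    exact ⟨h1.1, le_of_lt h2⟩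
  · rw [← Icc_union_Icc_eq_Icc hab hbd]
    exact (h₁ t ⟨hab, le_rfl⟩).union (h₂ t ⟨le_rfl, hbd⟩)
  · refine (h₂ t ⟨h.le, ht.2⟩).mono_of_mem_nhdsWithin ?_
    filter_upwards [self_mem_nhdsWithin, mem_nhdsWithin_of_mem_nhds (Ioi_mem_nhds h)] with σ h1 h2
    exact ⟨le_of_lt h2, h1.2⟩

/-- Comparison with the zero field shows, by uniqueness, that a parallel field which is nonzero once
never vanishes. -/
lemma isParallelOn_zero (nabla : AffineConnection n M) (hc : ContinuousOn c s) :
    IsParallelOn nabla c s fun _ ↦ 0 := fun t ht ↦ by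
  have h0 (x p : M) (hp : p ∈ (chartAt (Rn n) x).source) :
      comps x ⟨p, (0 : TangentSpace (𝓡 n) p)⟩ = 0 := by
    rw [comps_eq hp, map_zero]
  have e : frame (c t) (0 : Rn n) = 0 :=
    funext fun p ↦ ((trivializationAt (Rn n) (TangentSpace (𝓡 n)) (c t)).symmL ℝ p).map_zero
  have hx := mem_chart_source (Rn n) (c t)
  rw [h0 _ _ hx, e, nabla.zero]
  have e2 : comps (c t) ⟨c t, (0 : Π p : M, TangentSpace (𝓡 n) p →L[ℝ] TangentSpace (𝓡 n) p) (c t)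
      (velocity c t)⟩ = 0 := h0 _ _ hx
  rw [e2, neg_zero]
  refine (hasDerivWithinAt_const t s (0 : Rn n)).congr_of_eventuallyEq_of_mem ?_ ht
  filter_upwards [hc t ht ((chartAt (Rn n) (c t)).open_source.mem_nhds hx)] with σ hσ
  exact h0 _ _ hσ

/-- Parallel fields along `c` on `[a, b]` exist and are unique, given the value at any time. -/
def HasTransport (nabla : AffineConnection n M) (c : ℝ → M) (a b : ℝ) : Prop :=
  ∀ t ∈ Icc a b,
    (∀ v, ∃ W : Π t : ℝ, TangentSpace (𝓡 n) (c t), IsParallelOn nabla c (Icc a b) W ∧ W t = v) ∧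
    ∀ W₁ W₂ : Π t : ℝ, TangentSpace (𝓡 n) (c t), IsParallelOn nabla c (Icc a b) W₁ →
      IsParallelOn nabla c (Icc a b) W₂ → W₁ t = W₂ t → ∀ σ ∈ Icc a b, W₁ σ = W₂ σ

lemma HasTransport.trans (h₁ : HasTransport nabla c a b) (h₂ : HasTransport nabla c b d)
    (hab : a ≤ b) (hbd : b ≤ d) : HasTransport nabla c a d := by
  have hs₁ : Icc a b ⊆ Icc a d := Icc_subset_Icc_right hbd
  have hs₂ : Icc b d ⊆ Icc a d := Icc_subset_Icc_left hab
  have glue {W₁ W₂ : Π t : ℝ, TangentSpace (𝓡 n) (c t)} (hW₁ : IsParallelOn nabla c (Icc a b) W₁)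
      (hW₂ : IsParallelOn nabla c (Icc b d) W₂) (hb : W₁ b = W₂ b) :
      ∃ W, IsParallelOn nabla c (Icc a d) W ∧ (∀ t ∈ Icc a b, W t = W₁ t) ∧
        ∀ t ∈ Icc b d, W t = W₂ t := by
    have e₁ : ∀ t ∈ Icc a b, (if t ≤ b then W₁ t else W₂ t) = W₁ t := fun t ht ↦ if_pos ht.2
    have e₂ : ∀ t ∈ Icc b d, (if t ≤ b then W₁ t else W₂ t) = W₂ t := fun t ht ↦ by
      rcases ht.1.eq_or_lt with rfl | h
      · rw [if_pos le_rfl, hb]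
      · exact if_neg h.not_ge
    exact ⟨_, (hW₁.congr e₁).glue (hW₂.congr e₂) hab hbd, e₁, e₂⟩
  have ext {W₁ W₂ : Π t : ℝ, TangentSpace (𝓡 n) (c t)} (e₁ : ∀ t ∈ Icc a b, W₁ t = W₂ t)
      (e₂ : ∀ t ∈ Icc b d, W₁ t = W₂ t) (t : ℝ) (ht : t ∈ Icc a d) : W₁ t = W₂ t := by
    rcases le_total t b with h | h
    · exact e₁ t ⟨ht.1, h⟩
    · exact e₂ t ⟨h, ht.2⟩
  have mb₁ : b ∈ Icc a b := ⟨hab, le_rfl⟩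
  have mb₂ : b ∈ Icc b d := ⟨le_rfl, hbd⟩
  intro t ht
  rcases le_total t b with h | h
  · have mt : t ∈ Icc a b := ⟨ht.1, h⟩
    refine ⟨fun v ↦ ?_, fun V₁ V₂ hV₁ hV₂ h0 ↦ ?_⟩
    · obtain ⟨V₁, hV₁, rfl⟩ := (h₁ t mt).1 v
      obtain ⟨V₂, hV₂, hb⟩ := (h₂ b mb₂).1 (V₁ b)
      obtain ⟨V, hV, e, -⟩ := glue hV₁ hV₂ hb.symm
      exact ⟨V, hV, e t mt⟩
    · have e := (h₁ t mt).2 V₁ V₂ (hV₁.mono hs₁) (hV₂.mono hs₁) h0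
      exact ext e ((h₂ b mb₂).2 V₁ V₂ (hV₁.mono hs₂) (hV₂.mono hs₂) (e b mb₁))
  · have mt : t ∈ Icc b d := ⟨h, ht.2⟩
    refine ⟨fun v ↦ ?_, fun V₁ V₂ hV₁ hV₂ h0 ↦ ?_⟩
    · obtain ⟨V₂, hV₂, rfl⟩ := (h₂ t mt).1 v
      obtain ⟨V₁, hV₁, hb⟩ := (h₁ b mb₁).1 (V₂ b)
      obtain ⟨V, hV, -, e⟩ := glue hV₁ hV₂ hb
      exact ⟨V, hV, e t mt⟩
    · have e := (h₂ t mt).2 V₁ V₂ (hV₁.mono hs₂) (hV₂.mono hs₂) h0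
      exact ext ((h₁ b mb₁).2 V₁ V₂ (hV₁.mono hs₁) (hV₂.mono hs₁) (e b mb₂)) e

variable (h : RMetric n M)

/-- Close to `t₀` the curve stays in one chart and the coefficient of the linear equation is
bounded, so the short-interval results apply. -/
lemma exists_ball_hasTransport (hn : IsLeviCivita h nabla)
    (hc : ContMDiffOn 𝓘(ℝ, ℝ) (𝓡 n) 1 c (Icc 0 1)) {t₀ : ℝ} (ht₀ : t₀ ∈ Icc (0 : ℝ) 1) :
    ∃ r > 0, ∀ a b, Icc a b ⊆ Icc (0 : ℝ) 1 → Icc a b ⊆ Metric.ball t₀ r →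
      HasTransport nabla c a b := by
  set x := c t₀
  set S := Icc (0 : ℝ) 1 ∩ c ⁻¹' (chartAt (Rn n) x).source with hS
  set A : ℝ → Rn n →L[ℝ] Rn n := fun t ↦
    -christoffel h x (chartAt (Rn n) x (c t)) (comps x ⟨c t, velocity c t⟩) with hA
  have hAc : ContinuousOn A S := by
    refine (continuousOn_christoffel h ?_ (continuousOn_comps_velocity hc inter_subset_left
      fun t ht ↦ ht.2) ?_).neg
    · exact (chartAt (Rn n) x).continuousOn.comp (hc.continuousOn.mono inter_subset_left)
        fun t ht ↦ ht.2
    · exact fun t ht ↦ (chartAt (Rn n) x).map_source ht.2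
  have hx : t₀ ∈ S := ⟨ht₀, mem_chart_source (Rn n) x⟩
  have hSn : S ∈ nhdsWithin t₀ (Icc 0 1) := Filter.inter_mem self_mem_nhdsWithin
    (hc.continuousOn t₀ ht₀ ((chartAt (Rn n) x).open_source.mem_nhds hx.2))
  have hAt : ContinuousWithinAt A (Icc 0 1) t₀ := (hAc t₀ hx).mono_of_mem_nhdsWithin hSn
  set K := ‖A t₀‖ + 1 with hK
  have hK0 : 0 < K := by positivity
  have hev : ∀ᶠ t in nhdsWithin t₀ (Icc 0 1), t ∈ S ∧ ‖A t‖ < K :=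
    Filter.Eventually.and hSn (hAt.norm.eventually_lt_const (lt_add_one _))
  obtain ⟨r, hr, hsub⟩ := Metric.mem_nhdsWithin_iff.1 hev
  -- An interval inside a ball of radius `1 / (4 K)` has length at most `1 / (2 K)`.
  refine ⟨min r (1 / (4 * K)), lt_min hr (by positivity), fun a b h01 hball t ht ↦ ?_⟩
  have hab : a ≤ b := ht.1.trans ht.2
  have hm : ∀ t ∈ Icc a b, t ∈ S ∧ ‖A t‖ < K := fun t ht ↦
    hsub ⟨Metric.ball_subset_ball (min_le_left _ _) (hball ht), h01 ht⟩
  have hlen : K * (b - a) ≤ 1 / 2 := by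
    have h1 := hball (left_mem_Icc.2 hab)
    have h2 := hball (right_mem_Icc.2 hab)
    rw [Metric.mem_ball, Real.dist_eq, abs_lt] at h1 h2
    have h3 : min r (1 / (4 * K)) ≤ 1 / (4 * K) := min_le_right _ _
    have h4 : b - a ≤ 2 * (1 / (4 * K)) := by linarith
    calc K * (b - a) ≤ K * (2 * (1 / (4 * K))) := mul_le_mul_of_nonneg_left h4 hK0.le
      _ = 1 / 2 := by field_simp; norm_num
  have hAc' : ContinuousOn A (Icc a b) := hAc.mono fun t ht ↦ (hm t ht).1
  have hb : ∀ t ∈ Icc a b, ‖A t‖ ≤ K := fun t ht ↦ (hm t ht).2.le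
  have hsrc : ∀ t ∈ Icc a b, c t ∈ (chartAt (Rn n) x).source := fun t ht ↦ (hm t ht).1.2
  have hiff := isParallelOn_iff h hn hc h01 hsrc
  refine ⟨fun v ↦ ?_, fun W₁ W₂ hW₁ hW₂ h0 σ hσ ↦ ?_⟩
  · obtain ⟨w, hw, hd⟩ := exists_linearODE_solution hAc' hb hlen ht (comps x ⟨c t, v⟩)
    have e : ∀ σ ∈ Icc a b, comps x ⟨c σ, frame x (w σ) (c σ)⟩ = w σ := fun σ hσ ↦
      comps_frame (hsrc σ hσ) _
    refine ⟨fun σ ↦ frame x (w σ) (c σ), (hiff _).2 fun σ hσ ↦ ?_, ?_⟩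
    · have h1 := (hd σ hσ).congr e (e σ hσ)
      rw [e σ hσ]
      exact h1
    · exact (congrArg (fun v ↦ frame x v (c t)) hw).trans (frame_comps (hsrc t ht) v)
  · have key := eqOn_of_linearODE_solution hb hlen ht ((hiff W₁).1 hW₁) ((hiff W₂).1 hW₂)
      (by rw [h0]) hσ
    rw [← frame_comps (hsrc σ hσ) (W₁ σ), ← frame_comps (hsrc σ hσ) (W₂ σ)]
    exact congrArg (fun v ↦ frame x v (c σ)) key

lemma hasTransport (hn : IsLeviCivita h nabla) (hc : ContMDiffOn 𝓘(ℝ, ℝ) (𝓡 n) 1 c (Icc 0 1)) :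
    HasTransport nabla c 0 1 := by
  choose r hr hr' using
    fun t : Icc (0 : ℝ) 1 ↦ exists_ball_hasTransport h hn hc t.2
  -- A subdivision of `[0, 1]` subordinate to the local balls; the pieces are then joined by
  -- `HasTransport.trans`.
  obtain ⟨t, h0, hmono, ⟨m, hm⟩, hsub⟩ := exists_monotone_Icc_subset_open_cover_Icc
    (zero_le_one (α := ℝ)) (c := fun i : Icc (0 : ℝ) 1 ↦ Subtype.val ⁻¹' Metric.ball (i : ℝ) (r i))
    (fun i ↦ Metric.isOpen_ball.preimage continuous_subtype_val)
    (fun i _ ↦ mem_iUnion.2 ⟨i, Metric.mem_ball_self (hr i)⟩)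
  have h01 (k : ℕ) : Icc (t k : ℝ) (t (k + 1)) ⊆ Icc (0 : ℝ) 1 :=
    Icc_subset_Icc (t k).2.1 (t (k + 1)).2.2
  have step (k : ℕ) : HasTransport nabla c (t k) (t (k + 1)) := by
    obtain ⟨i, hi⟩ := hsub k
    exact hr' i _ _ (h01 k) fun σ hσ ↦ hi (show (⟨σ, h01 k hσ⟩ : Icc (0 : ℝ) 1) ∈ _ from hσ)
  have key (k : ℕ) : HasTransport nabla c 0 (t (k + 1)) := by
    induction k with
    | zero => simpa [h0] using step 0
    | succ k ih => exact ih.trans (step (k + 1)) (t (k + 1)).2.1 (hmono (Nat.le_succ _))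
  have e : (t (m + 1) : ℝ) = 1 := hm (m + 1) (Nat.le_succ m)
  exact e ▸ key m

end Transport

/-! ### Horizontal curves and preservation of the indicatrix -/

section Horizontal

variable {n : ℕ} {M : Type*} [TopologicalSpace M] [ChartedSpace (Rn n) M]
  [IsManifold (𝓡 n) ∞ M] {c : ℝ → M} {nabla : AffineConnection n M}
  {F : TangentBundle (𝓡 n) M → ℝ}

/-- This is `Γⁱ_{jk} yᵏ = Nⁱ_j` at `y = u`; symmetry of `Γ` allows `u` to occupy the other lower
slot. -/
lemma contract_chernCoeff (hF : IsBerwald F) (x : M) {u : Rn n} (hu : u ≠ 0) (X : Rn n) :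
    NatCoord.contract (chernCoeff F x) u X = WithLp.toLp 2 fun i ↦
      ∑ j, NatCoord.nonlinear (localF F x) (chartAt (Rn n) x x) u i j * X j := by
  have H := isLocalFinsler_localF hF.toIsFinsler x
  ext i
  simp only [NatCoord.contract]
  rw [Finset.sum_comm]
  refine Finset.sum_congr rfl fun j _ ↦ ?_
  rw [← H.sum_chern (mem_chart_target (Rn n) x) hu, chern_eq_chernCoeff hF x hu, Finset.sum_mul]
  exact Finset.sum_congr rfl fun k _ ↦ by rw [chernCoeff_symm hF.toIsFinsler]

lemma isHorizontalLift_iff (hF : IsBerwald F) {h : RMetric n M} (hpar : BerwaldParallel F h)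
    (hn : IsLeviCivita h nabla) (U : Π t : ℝ, TangentSpace (𝓡 n) (c t)) :
    IsHorizontalLift F c U ↔ IsParallelAlong nabla c U ∧ ∀ t ∈ Icc (0 : ℝ) 1, U t ≠ 0 := by
  rw [IsParallelAlong, ← forall₂_and]
  refine forall₂_congr fun t _ ↦ ?_
  rw [and_comm]
  refine and_congr_left fun hU ↦ ?_
  have e := (nabla_extend_eq_contract hF hpar hn (velocity c t) (U t)).trans
    (contract_chernCoeff hF (c t) hU (velocity c t))
  refine iff_of_eq (congrArg (fun w : Rn n ↦ HasDerivWithinAt (fun σ ↦ comps (c t) ⟨c σ, U σ⟩)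
    w (Icc 0 1) t) ?_)
  refine Eq.trans ?_ (congrArg (fun w : Rn n ↦ -w) e).symm
  ext i
  rfl

/-- By the chain rule the derivative is `ċʲ δφ/δxʲ`, which vanishes by `horiz_self`. This holds for
every Finsler structure, Berwald or not. -/
lemma hasDerivWithinAt_finsler (hF : IsFinsler F) (hc : ContMDiffOn 𝓘(ℝ, ℝ) (𝓡 n) 1 c (Icc 0 1))
    {U : Π t : ℝ, TangentSpace (𝓡 n) (c t)} (hU : IsHorizontalLift F c U) {t : ℝ}
    (ht : t ∈ Icc (0 : ℝ) 1) :
    HasDerivWithinAt (fun σ ↦ F ⟨c σ, U σ⟩) 0 (Icc 0 1) t := by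
  have H := isLocalFinsler_localF hF (c t)
  have hx := mem_chart_source (Rn n) (c t)
  have hy := mem_chart_target (Rn n) (c t)
  obtain ⟨h0, hd⟩ := hU t ht
  have h1 := hasDerivWithinAt_chart_curve hc ht le_rfl hx
  rw [comps_self] at h1
  have e0 : (chartAt (Rn n) (c t) (c t), comps (c t) ⟨c t, U t⟩)
      = (chartAt (Rn n) (c t) (c t), (U t : Rn n)) :=
    congrArg (Prod.mk _) (comps_self _ _)
  have hf : HasFDerivAt (Function.uncurry (localF F (c t)))
      (fderiv ℝ (Function.uncurry (localF F (c t))) (chartAt (Rn n) (c t) (c t), (U t : Rn n)))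
      (chartAt (Rn n) (c t) (c t), comps (c t) ⟨c t, U t⟩) :=
    e0.symm ▸ (H.smooth.differentiableAt H.isOpen hy h0).hasFDerivAt
  have h2 := hf.comp_hasDerivWithinAt (f := fun σ ↦
    (chartAt (Rn n) (c t) (c σ), comps (c t) ⟨c σ, U σ⟩)) t (h1.prodMk hd)
  have e1 : ∀ X : Rn n, ∑ k, X k * NatCoord.dx k (localF F (c t)) (chartAt (Rn n) (c t) (c t)) (U t)
      + ∑ i, (WithLp.toLp 2 fun i ↦ -∑ j, NatCoord.nonlinear (localF F (c t))
          (chartAt (Rn n) (c t) (c t)) (U t) i j * X j : Rn n) i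
        * NatCoord.dy i (localF F (c t)) (chartAt (Rn n) (c t) (c t)) (U t) = 0 := by
    intro X
    have : ∑ j, X j * NatCoord.horiz (localF F (c t)) j (localF F (c t))
        (chartAt (Rn n) (c t) (c t)) (U t) = 0 :=
      Finset.sum_eq_zero fun j _ ↦ by rw [H.horiz_self hy h0, mul_zero]
    rw [← this]
    simp only [NatCoord.horiz, neg_mul, Finset.sum_neg_distrib, Finset.sum_mul]
    rw [Finset.sum_comm, ← sub_eq_add_neg, ← Finset.sum_sub_distrib]
    refine Finset.sum_congr rfl fun j _ ↦ ?_
    rw [mul_sub, Finset.mul_sum]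
    exact congrArg _ (Finset.sum_congr rfl fun i _ ↦ by ring)
  have h3 := h2.congr_deriv ((H.smooth.fderiv_apply H.isOpen hy h0 _ _).trans (e1 _))
  have hcont := hc.continuousOn t ht ((chartAt (Rn n) (c t)).open_source.mem_nhds hx)
  refine h3.congr_of_eventuallyEq_of_mem ?_ ht
  filter_upwards [hcont] with σ hσ
  refine Eq.symm ((localF_apply F hσ (comps (c t) ⟨c σ, U σ⟩)).trans ?_)
  exact congrArg (fun w ↦ F ⟨c σ, w⟩) (frame_comps hσ (U σ))

lemma finsler_horizontalLift (hF : IsFinsler F) (hc : ContMDiffOn 𝓘(ℝ, ℝ) (𝓡 n) 1 c (Icc 0 1))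
    {U : Π t : ℝ, TangentSpace (𝓡 n) (c t)} (hU : IsHorizontalLift F c U) :
    F ⟨c 1, U 1⟩ = F ⟨c 0, U 0⟩ :=
  constant_of_derivWithin_zero (f := fun σ ↦ F ⟨c σ, U σ⟩)
    (fun _ ht ↦ (hasDerivWithinAt_finsler hF hc hU ht).differentiableWithinAt)
    (fun t ht ↦ (hasDerivWithinAt_finsler hF hc hU (Ico_subset_Icc_self ht)).derivWithin
      (uniqueDiffOn_Icc one_pos t (Ico_subset_Icc_self ht))) 1 (right_mem_Icc.2 zero_le_one)

lemma finsler_zero (hF : IsFinsler F) (x : M) : F ⟨x, 0⟩ = 0 := by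
  have := hF.homogeneous x 0 2 two_pos
  rw [smul_zero] at this
  linarith

lemma ne_zero_of_mem_indicatrix (hF : IsFinsler F) {x : M} {v : TangentSpace (𝓡 n) x}
    (hv : v ∈ indicatrix F x) : v ≠ 0 := by
  rintro rfl
  exact zero_ne_one ((finsler_zero hF x).symm.trans hv)

lemma IsParallelOn.isHorizontalLift (hF : IsBerwald F) {h : RMetric n M}
    (hpar : BerwaldParallel F h) (hn : IsLeviCivita h nabla)
    (hc : ContMDiffOn 𝓘(ℝ, ℝ) (𝓡 n) 1 c (Icc 0 1)) {W : Π t : ℝ, TangentSpace (𝓡 n) (c t)}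
    (hW : IsParallelOn nabla c (Icc 0 1) W) {t : ℝ} (ht : t ∈ Icc (0 : ℝ) 1) (h0 : W t ≠ 0) :
    IsHorizontalLift F c W := by
  rw [isHorizontalLift_iff hF hpar hn, isParallelAlong_iff]
  -- A zero at time `σ` would make `W` agree with the zero field everywhere, including at `t`.
  exact ⟨hW, fun σ hσ hσ0 ↦ h0 ((hasTransport h hn hc σ hσ).2 W (fun _ ↦ 0) hW
    (isParallelOn_zero nabla hc.continuousOn) hσ0 t ht)⟩

lemma exists_unique_isParallelTransport (h : RMetric n M) (hn : IsLeviCivita h nabla)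
    (hc : ContMDiffOn 𝓘(ℝ, ℝ) (𝓡 n) 1 c (Icc 0 1)) :
    ∃! τ : TangentSpace (𝓡 n) (c 0) → TangentSpace (𝓡 n) (c 1),
      IsParallelTransport nabla c τ := by
  obtain ⟨hex, huniq⟩ := hasTransport h hn hc 0 (left_mem_Icc.2 zero_le_one)
  choose W hW hW0 using hex
  refine ⟨fun v ↦ W v 1, fun v ↦ ⟨W v, (isParallelAlong_iff nabla _).2 (hW v), hW0 v, rfl⟩,
    fun τ hτ ↦ funext fun v ↦ ?_⟩
  obtain ⟨V, hV, hV0, hV1⟩ := hτ v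
  rw [← hV1]
  exact huniq V (W v) ((isParallelAlong_iff nabla _).1 hV) (hW v) (hV0.trans (hW0 v).symm) 1
    (right_mem_Icc.2 zero_le_one)

lemma IsParallelTransport.image_indicatrix (hF : IsBerwald F) {h : RMetric n M}
    (hpar : BerwaldParallel F h) (hn : IsLeviCivita h nabla)
    (hc : ContMDiffOn 𝓘(ℝ, ℝ) (𝓡 n) 1 c (Icc 0 1))
    {τ : TangentSpace (𝓡 n) (c 0) → TangentSpace (𝓡 n) (c 1)}
    (hτ : IsParallelTransport nabla c τ) :
    τ '' indicatrix F (c 0) = indicatrix F (c 1) := by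
  have m0 : (0 : ℝ) ∈ Icc (0 : ℝ) 1 := left_mem_Icc.2 zero_le_one
  have m1 : (1 : ℝ) ∈ Icc (0 : ℝ) 1 := right_mem_Icc.2 zero_le_one
  ext w
  constructor
  · rintro ⟨v, hv, rfl⟩
    obtain ⟨V, hV, rfl, h1⟩ := hτ v
    have hV' := ((isParallelAlong_iff nabla _).1 hV).isHorizontalLift hF hpar hn hc m0
      (ne_zero_of_mem_indicatrix hF.toIsFinsler hv)
    rw [← h1]
    exact (finsler_horizontalLift hF.toIsFinsler hc hV').trans hv
  · intro hw
    -- For surjectivity, the parallel field is prescribed at time `1`; its value at time `0` is the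
    -- preimage, and uniqueness identifies it with the field that defines `τ`.
    obtain ⟨W, hW, rfl⟩ := (hasTransport h hn hc 1 m1).1 w
    have hW' := hW.isHorizontalLift hF hpar hn hc m1
      (ne_zero_of_mem_indicatrix hF.toIsFinsler hw)
    refine ⟨W 0, (finsler_horizontalLift hF.toIsFinsler hc hW').symm.trans hw, ?_⟩
    obtain ⟨V, hV, h0, h1⟩ := hτ (W 0)
    rw [← h1]
    exact (hasTransport h hn hc 0 m0).2 V W ((isParallelAlong_iff nabla _).1 hV) hW h0 1 m1

end Horizontal

theorem proposition5p3p6 {n : ℕ} {M : Type*} [TopologicalSpace M] [T2Space M]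
    [ChartedSpace (Rn n) M] [IsManifold (𝓡 n) ∞ M]
    (F : TangentBundle (𝓡 n) M → ℝ) (hF : IsBerwald F)
    (h : RMetric n M) (hpar : BerwaldParallel F h) :
    (∃ nabla : AffineConnection n M, IsLeviCivita h nabla) ∧
    ∀ nabla : AffineConnection n M, IsLeviCivita h nabla →
      (∀ (x : M) (X : TangentSpace (𝓡 n) x) (Y : Π p : M, TangentSpace (𝓡 n) p),
        DifferentiableFieldAt Y x →
          nabla Y x X = averagedBerwald F x X Y ∧
          ∀ u : TangentSpace (𝓡 n) x, u ≠ 0 →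
            nabla Y x X = berwaldDeriv F x u X Y ∧ nabla Y x X = chernDeriv F x u X Y) ∧
      ∀ c : ℝ → M, ContMDiffOn 𝓘(ℝ, ℝ) (𝓡 n) 1 c (Icc 0 1) →
        (∀ U : Π t : ℝ, TangentSpace (𝓡 n) (c t),
          IsHorizontalLift F c U ↔
            IsParallelAlong nabla c U ∧ ∀ t ∈ Icc (0 : ℝ) 1, U t ≠ 0) ∧
        (∃! τ : TangentSpace (𝓡 n) (c 0) → TangentSpace (𝓡 n) (c 1),
          IsParallelTransport nabla c τ) ∧
        ∀ τ : TangentSpace (𝓡 n) (c 0) → TangentSpace (𝓡 n) (c 1),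
          IsParallelTransport nabla c τ → τ '' indicatrix F (c 0) = indicatrix F (c 1) := by
  refine ⟨⟨_, isLeviCivita_connectionOfCoeff hF hpar⟩, fun nabla hn ↦ ⟨fun x X Y hY ↦ ?_,
    fun c hc ↦ ⟨isHorizontalLift_iff hF hpar hn, exists_unique_isParallelTransport h hn hc,
      fun τ hτ ↦ hτ.image_indicatrix hF hpar hn hc⟩⟩⟩
  have key := nabla_eq_natDeriv hF hpar hn X hY
  exact ⟨key.trans (averagedBerwald_eq hF x X Y).symm, fun u hu ↦
    ⟨key.trans (berwaldDeriv_eq hF x hu X Y).symm, key.trans (chernDeriv_eq hF x hu X Y).symm⟩⟩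

end
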